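/- **Theorem (consistency of the odd-order multi-product expansion).** Let $n\ge 1$, let $S$ be a set of $n$ positive integers (the standard choice is $S=\{1,\dots,n\}$), and put $k_i=2i-1$ for $i\in S$. Let $$\tilde c_i=\prod_{j\in S,\ j\ne i}\frac{k_i^2}{k_i^2-k_j^2}\qquad(i\in S).$$ These are the unique solution of the Vandermonde system $\sum_{i\in S}\tilde c_i=1$, $\sum_{i\in S}\tilde c_i k_i^{-2r}=0$ for $1\le r\le n-1$. For operators $A,B$ let $$\mathcal U_i(h)=e^{\frac{h}{2i-1}A}\Bigl(e^{\frac{2h}{2i-1}B}e^{\frac{2h}{2i-1}A}\Bigr)^{i-1}e^{\frac{h}{2i-1}B}.$$ (a) Autonomous case. If $A,B$ are elements of a real Banach algebra (for example bounded operators on a Banach space), then $$\Bigl\|\sum_{i\in S}\tilde c_i\,\mathcal U_i(h)-e^{h(A+B)}\Bigr\|=O(h^{2n})\qquad(h\to0).$$ (b) Non-autonomous case $Y'(t)=A(t)Y(t)$. Let $T>0$ and let $A$ be a function with values in a real Banach algebra $\mathbb A$ that is $2n-1$ times continuously differentiable on $[0,T]$. Let $D$ be the forward time derivative. The operators below act from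 the right on functions $F$ of time with values in $\mathbb A$ (in a product the left factor acts first): $(Fe^{aA})(t)=F(t)e^{aA(t)}$ and $(Fe^{aD})(t)=F(t+a)$. For $0\le t\le t+h\le T$ the limit $$\bigl(F\,e^{h(A+D)}\bigr)(t)=\lim_{N\to\infty}\Bigl(F\,\bigl(e^{\frac hN A}e^{\frac hN D}\bigr)^N\Bigr)(t)$$ exists for every $F$. For each $t\in[0,T]$ the function $Y(s)=\bigl(1\,e^{(s-t)(A+D)}\bigr)(t)$ satisfies $Y(t)=1$ and $Y'(s)=A(s)Y(s)$ on $[t,T]$. With $B=D$ in $\mathcal U_i$, there are constants $C$ and $h_0>0$ such that for all $0\le h\le h_0$, all $t$ with $0\le t\le t+h\le T$, and all $F$ with $\|F\|\le K$ on $[0,T]$, $$\Bigl\|\Bigl(F\Bigl[\sum_{i\in S}\tilde c_i\,\mathcal U_i(h)-e^{h(A+D)}\Bigr]\Bigr)(t)\Bigr\|\le C\,h^{2n}K .$$ The same holds when the roles of $A$ and $D$ in $\mathcal U_i$ are exchanged. -/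

import Mathlib

open MulOpposite Filter

noncomputable section

/-- The node `k_i = 2 i - 1` belonging to the `i`-th basis product. -/
def oddNode (i : ℕ) : ℝ := 2 * (i : ℝ) - 1

/-- The Vandermonde system in the variables `k_i⁻²`, `i ∈ S`, with right-hand side `(1, 0, …, 0)`:
`∑ c_i = 1` and `∑ c_i k_i^(-2 r) = 0` for `1 ≤ r < #S`. -/
def SolvesVandermonde (S : Finset ℕ) (c : ℕ → ℝ) : Prop :=
  ∀ r < S.card, ∑ i ∈ S, c i * (oddNode i ^ (2 * r))⁻¹ = if r = 0 then 1 else 0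

/-- The coefficients `c_i = ∏_{j ≠ i} k_i² / (k_i² - k_j²)`. -/
def mpeCoeff (S : Finset ℕ) (i : ℕ) : ℝ :=
  ∏ j ∈ S.erase i, oddNode i ^ 2 / (oddNode i ^ 2 - oddNode j ^ 2)

/-- The basis product `P(h/x) (Q(2h/x) P(2h/x))^(n-1) Q(h/x)`, `x = 2 n - 1`, built from two
families `P`, `Q` (to be thought of as `s ↦ e^{sA}`, `s ↦ e^{sB}`). -/
def oddBasis {M : Type*} [Monoid M] (P Q : ℝ → M) (n : ℕ) (h : ℝ) : M :=
  P (h / oddNode n) * (Q (2 * h / oddNode n) * P (2 * h / oddNode n)) ^ (n - 1) *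
    Q (h / oddNode n)

/-- `∑_{i ∈ S} c_i 𝒰_i(h)`. -/
def mpeSum {M : Type*} [Monoid M] [AddCommMonoid M] [Module ℝ M]
    (S : Finset ℕ) (P Q : ℝ → M) (h : ℝ) : M :=
  ∑ i ∈ S, mpeCoeff S i • oddBasis P Q i h

section Nonautonomous

variable (𝔸 : Type*) [NormedRing 𝔸] [NormedAlgebra ℝ 𝔸]

/-- Linear operators on time-dependent functions `F : ℝ → 𝔸` that act from the right:
in a product `X * Y` the factor `X` is applied to the function first,
`F (X Y) = (F X) Y`. -/
abbrev RightOp : Type _ := (Module.End ℝ (ℝ → 𝔸))ᵐᵒᵖ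

variable {𝔸}

/-- The value `F X` of a right-acting operator. -/
def RightOp.act (F : ℝ → 𝔸) (X : RightOp 𝔸) : ℝ → 𝔸 := X.unop F

/-- `e^{aA(t)}`: multiplication from the right, `(F e^{aA})(t) = F(t) e^{a A(t)}`. -/
def expMulOp (A : ℝ → 𝔸) (a : ℝ) : RightOp 𝔸 :=
  op (LinearMap.mulRight ℝ (fun t : ℝ => NormedSpace.exp (a • A t)))

/-- `e^{aD}` for the forward time derivative `D`, which acts on everything to its left:
`(F e^{aD})(t) = F(t + a)`. -/
def expShiftOp (a : ℝ) : RightOp 𝔸 :=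
  op (LinearMap.funLeft ℝ 𝔸 (fun t : ℝ => t + a))

/-- `exp(h(A + D))`, applied to `F` at time `t`, as the limit of `(e^{(h/N)A} e^{(h/N)D})^N`. -/
def expAddD (A : ℝ → 𝔸) (h : ℝ) (F : ℝ → 𝔸) (t : ℝ) : 𝔸 :=
  limUnder atTop (fun N : ℕ =>
    RightOp.act F ((expMulOp A (h / N) * expShiftOp (h / N)) ^ N) t)

end Nonautonomous

end

open scoped PowerSeries Topology

/-! ### Extrapolation weights as Lagrange basis values at zero. -/

section Vandermonde

/-! The core is an identity of formal power series, valid in every real algebra. Put `1 + N = e^A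
e^{2B} e^A`. With the step rescaled by `k = 2i - 1`, the `i`-th basis product is `(1 + N)^((k-1)/2)
e^A e^B`. Read as a binomial series, this makes sense for every real `k`, and its coefficient of
degree `m` is a polynomial in `k` of degree at most `m`, because `N` has no constant term. The
palindrome `1 + N` is inverted by changing the sign of the step, so replacing `k` by `-k` multiplies
that coefficient by `(-1)^m` at the nodes (`dilate_neg_one_oddPow_neg`). Divided by `k^m`, it is
therefore at the nodes a polynomial in `k⁻²` of degree at most `m/2`, and for `m < 2n` the weights
extrapolate it to `k⁻² = 0`. What remains is the leading coefficient `(1/2)^m/m! · (2(A+B))^m`,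
which is the exponential term (`sum_mpeCoeff_mul_symm_eval`, `coeff_mpeSum_expOf`).

To turn this into estimates, the formal letters become right-acting operators on polynomials in
time: multiplication by a polynomial `a`, and `d/dt`. The actual multiplication and shift operators
agree with the formal exponentials up to `O(h^N)`, jointly in step and time (`realizes_expMulOp`,
`realizes_expShiftOp`), and this relation is stable under products. Constant polynomials give the
autonomous case.

For a general `A(t)`, Euler products converge to the solution `X` of the linear equation started
from `1` at `t` (`tendsto_eulerProd`), so `e^{h(A+D)}` sends `F` to `F(t+h) X(t+h)`. It remains to
compare propagators. Near `t`, `A` is replaced by its Taylor polynomial of degree `2n-2`; the error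
`O(h^{2n-1})` gains one factor `h` in the propagators (`exists_norm_prop_sub_le`) and in the
solution (`exists_norm_solution_sub_truncEval_le`). Uniformity in `t` comes from letting the Taylor
coefficients be elements of `C([0,T], 𝔸)`: a single estimate there, followed by the contractive
evaluation at `t`, serves all `t`. -/

lemma oddNode_pos {i : ℕ} (hi : 1 ≤ i) : 0 < oddNode i := by
  have : (1 : ℝ) ≤ i := by exact_mod_cast hi
  unfold oddNode; linarith

lemma oddNode_inv_sq_injOn {S : Finset ℕ} (hS : ∀ i ∈ S, 1 ≤ i) :
    Set.InjOn (fun i => (oddNode i ^ 2)⁻¹) (S : Set ℕ) := by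
  intro i hi j hj hij
  have hi' := oddNode_pos (hS i hi)
  have hj' := oddNode_pos (hS j hj)
  have h1 : oddNode i ^ 2 = oddNode j ^ 2 := inv_injective hij
  have h2 : oddNode i = oddNode j := by
    rwa [pow_left_inj₀ hi'.le hj'.le two_ne_zero] at h1
  unfold oddNode at h2
  exact_mod_cast (by linarith : (i : ℝ) = j)

/-- With `x = k⁻²`, each factor `k_i²/(k_i² - k_j²)` equals `(0 - x_j)/(x_i - x_j)`. -/
lemma mpeCoeff_eq_eval_basis {S : Finset ℕ} (hS : ∀ i ∈ S, 1 ≤ i) {i : ℕ} (hi : i ∈ S) :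
    mpeCoeff S i = (Lagrange.basis S (fun i => (oddNode i ^ 2)⁻¹) i).eval 0 := by
  unfold mpeCoeff Lagrange.basis
  rw [Polynomial.eval_prod]
  refine Finset.prod_congr rfl fun j hj => ?_
  have hjS := Finset.mem_of_mem_erase hj
  have hi' := oddNode_pos (hS i hi)
  have hj' := oddNode_pos (hS j hjS)
  have hne : oddNode i ^ 2 - oddNode j ^ 2 ≠ 0 := fun h =>
    Finset.ne_of_mem_erase hj
      ((oddNode_inv_sq_injOn hS hi hjS (by simp [sub_eq_zero.mp h])).symm)
  have hne' : (oddNode i ^ 2)⁻¹ - (oddNode j ^ 2)⁻¹ =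
      -(oddNode i ^ 2 - oddNode j ^ 2) / (oddNode i ^ 2 * oddNode j ^ 2) := by
    field_simp; ring
  simp only [Lagrange.basisDivisor, Polynomial.eval_mul, Polynomial.eval_C, Polynomial.eval_sub,
    Polynomial.eval_X, zero_sub]
  rw [hne']
  field_simp

/-- A solution of the Vandermonde system extrapolates polynomials of low degree to `0`. -/
lemma SolvesVandermonde.sum_eval {S : Finset ℕ} {c : ℕ → ℝ} (hc : SolvesVandermonde S c)
    {p : Polynomial ℝ} (hp : p.natDegree < S.card) :
    ∑ i ∈ S, c i * p.eval ((oddNode i ^ 2)⁻¹) = p.eval 0 := by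
  simp_rw [Polynomial.eval_eq_sum_range, Finset.mul_sum]
  rw [Finset.sum_comm]
  refine Finset.sum_congr rfl fun r hr => ?_
  have hr' : r < S.card := by
    have := Finset.mem_range.mp hr; omega
  have := hc r hr'
  calc _ = p.coeff r * ∑ i ∈ S, c i * (oddNode i ^ (2 * r))⁻¹ := by
        rw [Finset.mul_sum]
        refine Finset.sum_congr rfl fun i _ => ?_
        rw [pow_mul, inv_pow]; ring
    _ = _ := by
        rw [this]
        rcases eq_or_ne r 0 with rfl | h <;> simp [*]

lemma solvesVandermonde_mpeCoeff {S : Finset ℕ} (hS : ∀ i ∈ S, 1 ≤ i) :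
    SolvesVandermonde S (mpeCoeff S) := by
  intro r hr
  have hinj := oddNode_inv_sq_injOn hS
  have h := Lagrange.eq_interpolate (f := (Polynomial.X : Polynomial ℝ) ^ r) hinj
    (by rw [Polynomial.degree_X_pow]; exact_mod_cast hr)
  have h0 := congrArg (Polynomial.eval 0) h
  rw [Lagrange.interpolate_apply, Polynomial.eval_finsetSum] at h0
  simp only [Polynomial.eval_pow, Polynomial.eval_X, Polynomial.eval_mul, Polynomial.eval_C] at h0
  rw [← zero_pow_eq, h0]
  refine Finset.sum_congr rfl fun i hi => ?_
  rw [mpeCoeff_eq_eval_basis hS hi, pow_mul, inv_pow, mul_comm]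

lemma solvesVandermonde_iff {S : Finset ℕ} (hS : ∀ i ∈ S, 1 ≤ i) (c : ℕ → ℝ) :
    SolvesVandermonde S c ↔ ∀ i ∈ S, c i = mpeCoeff S i := by
  have hinj := oddNode_inv_sq_injOn hS
  constructor
  · intro hc i hi
    have hdeg : (Lagrange.basis S (fun i => (oddNode i ^ 2)⁻¹) i).natDegree < S.card := by
      rw [Lagrange.natDegree_basis hinj hi]
      have := Finset.card_pos.mpr ⟨i, hi⟩
      omega
    rw [mpeCoeff_eq_eval_basis hS hi, ← hc.sum_eval hdeg, Finset.sum_eq_single i]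
    · have := Lagrange.eval_basis_self hinj hi
      rw [this, mul_one]
    · intro j hj hji
      have := Lagrange.eval_basis_of_ne (v := fun i => (oddNode i ^ 2)⁻¹) hji.symm hj
      rw [this, mul_zero]
    · exact fun h => absurd hi h
  · intro h r hr
    rw [← solvesVandermonde_mpeCoeff hS r hr]
    exact Finset.sum_congr rfl fun i hi => by rw [h i hi]

/-- The weights `c_i k_i^{-m}` extract the leading coefficient from the part of a polynomial of
degree at most `m` that has the parity of `m`. -/
lemma sum_mpeCoeff_mul_symm_eval {S : Finset ℕ} (hS : ∀ i ∈ S, 1 ≤ i) {m : ℕ}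
    (hm : m < 2 * S.card) {p : Polynomial ℝ} (hp : p.natDegree ≤ m) :
    ∑ i ∈ S, mpeCoeff S i * ((oddNode i)⁻¹ ^ m *
      ((p.eval (oddNode i) + (-1) ^ m * p.eval (-oddNode i)) / 2)) = p.coeff m := by
  have hV := solvesVandermonde_mpeCoeff hS
  have key : ∀ j ∈ Finset.range (m + 1), ∑ i ∈ S, mpeCoeff S i * ((oddNode i)⁻¹ ^ m *
      ((oddNode i ^ j + (-1) ^ m * (-oddNode i) ^ j) / 2)) = if j = m then 1 else 0 := by
    intro j hj
    have hj : j ≤ m := Nat.lt_succ_iff.mp (Finset.mem_range.mp hj)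
    obtain ⟨d, rfl⟩ := Nat.exists_eq_add_of_le hj
    -- Here `d = m - j`. If `d = 2r`, the two evaluations agree and leave the moment of `k^(-2r)`,
    -- with `r < #S` because `2r ≤ m`; if `d` is odd, they cancel.
    rcases Nat.even_or_odd' d with ⟨r, rfl | rfl⟩
    · have h := hV r (by omega)
      calc _ = ∑ i ∈ S, mpeCoeff S i * (oddNode i ^ (2 * r))⁻¹ := by
            refine Finset.sum_congr rfl fun i hi => ?_
            have := (oddNode_pos (hS i hi)).ne'
            have h1 : (-1 : ℝ) ^ (j + 2 * r) * (-oddNode i) ^ j = oddNode i ^ j := by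
              rw [neg_pow (oddNode i), ← mul_assoc, ← pow_add, Even.neg_one_pow ⟨j + r, by ring⟩,
                one_mul]
            rw [h1, inv_pow, pow_add]
            field_simp
            ring
        _ = _ := by
            rw [h]
            congr 1
            simp
    · rw [if_neg (by omega)]
      refine Finset.sum_eq_zero fun i hi => ?_
      have h1 : (-1 : ℝ) ^ (j + (2 * r + 1)) * (-oddNode i) ^ j = -oddNode i ^ j := by
        rw [neg_pow (oddNode i), ← mul_assoc, ← pow_add, Odd.neg_one_pow ⟨j + r, by ring⟩]
        ring
      rw [h1]; ring
  have hev : ∀ x : ℝ, p.eval x = ∑ j ∈ Finset.range (m + 1), p.coeff j * x ^ j := fun x =>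
    Polynomial.eval_eq_sum_range' (Nat.lt_succ_of_le hp) x
  calc _ = ∑ j ∈ Finset.range (m + 1), p.coeff j * ∑ i ∈ S, mpeCoeff S i * ((oddNode i)⁻¹ ^ m *
      ((oddNode i ^ j + (-1) ^ m * (-oddNode i) ^ j) / 2)) := by
        simp_rw [Finset.mul_sum]
        rw [Finset.sum_comm]
        refine Finset.sum_congr rfl fun i _ => ?_
        rw [hev, hev, Finset.mul_sum, ← Finset.sum_add_distrib, Finset.sum_div, Finset.mul_sum,
          Finset.mul_sum]
        refine Finset.sum_congr rfl fun j _ => ?_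
        ring
    _ = _ := by
        rw [Finset.sum_congr rfl fun j hj => by rw [key j hj]]
        simp

end Vandermonde

/-! ### Formal exponentials, dilations and binomial series with noncommuting coefficients. -/

noncomputable section
namespace PowerSeries
variable {R : Type*} [Ring R] [Algebra ℝ R]

/-- The formal exponential `∑ c^m A^m X^m / m!` of `c X A`. -/
def expOf (A : R) (c : ℝ) : R⟦X⟧ := mk fun m => (c ^ m / m.factorial) • A ^ m

@[simp] lemma coeff_expOf (A : R) (c : ℝ) (m : ℕ) :
    coeff m (expOf A c) = (c ^ m / m.factorial) • A ^ m := by simp [expOf]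

@[simp] lemma constantCoeff_expOf (A : R) (c : ℝ) : constantCoeff (expOf A c) = 1 := by
  rw [← coeff_zero_eq_constantCoeff_apply, coeff_expOf]
  simp

lemma expOf_zero (A : R) : expOf A 0 = 1 := by
  ext m
  rcases eq_or_ne m 0 with rfl | hm <;> simp [coeff_one, *]

lemma expOf_mul_expOf (A : R) (c d : ℝ) : expOf A c * expOf A d = expOf A (c + d) := by
  ext m
  rw [coeff_mul, coeff_expOf, (Commute.all c d).add_pow', Finset.sum_div, Finset.sum_smul]
  refine Finset.sum_congr rfl fun p hp => ?_
  obtain ⟨i, j⟩ := p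
  have hp : i + j = m := by simpa using hp
  subst hp
  rw [coeff_expOf, coeff_expOf, smul_mul_smul_comm, pow_add]
  congr 1
  have h := Nat.add_choose_mul_factorial_mul_factorial i j
  rw [← Nat.choose_symm_add] at h
  have h' : ((i + j).choose i : ℝ) * i.factorial * j.factorial = (i + j).factorial := by
    exact_mod_cast h
  have h1 : (i.factorial : ℝ) ≠ 0 := by positivity
  have h2 : (j.factorial : ℝ) ≠ 0 := by positivity
  have h3 : ((i + j).factorial : ℝ) ≠ 0 := by positivity
  simp only [nsmul_eq_mul]
  field_simp
  rw [← h']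
  ring

/-- The substitution `X ↦ r X` for a real number `r`. -/
def dilate (r : ℝ) : R⟦X⟧ →+* R⟦X⟧ where
  toFun φ := mk fun m => r ^ m • coeff m φ
  map_one' := by
    ext m
    rcases eq_or_ne m 0 with rfl | hm <;> simp [coeff_one, *]
  map_zero' := by ext; simp
  map_add' φ ψ := by ext; simp
  map_mul' φ ψ := by
    ext m
    simp only [coeff_mk, coeff_mul, Finset.smul_sum]
    refine Finset.sum_congr rfl fun p hp => ?_
    rw [smul_mul_smul_comm, ← pow_add, Finset.HasAntidiagonal.mem_antidiagonal.mp hp]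

@[simp] lemma coeff_dilate (r : ℝ) (φ : R⟦X⟧) (m : ℕ) :
    coeff m (dilate r φ) = r ^ m • coeff m φ := by simp [dilate]

lemma dilate_expOf (r : ℝ) (A : R) (c : ℝ) : dilate r (expOf A c) = expOf A (r * c) := by
  ext m
  simp [smul_smul, mul_pow, mul_div_assoc]

section Shift
variable {R : Type*} [Ring R]

/-- `N` is a multiple of the central variable `X`. The order of `N^l` is thus at least `l`, which
makes binomial series in `N` finite in each degree. -/
lemma pow_eq_shift_pow_mul_X_pow {N : R⟦X⟧} (hN : constantCoeff N = 0) (l : ℕ) :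
    N ^ l = (mk fun p => coeff (p + 1) N) ^ l * X ^ l := by
  conv_lhs => rw [eq_shift_mul_X_add_const N]
  rw [hN, map_zero, add_zero, (commute_X _).mul_pow]

lemma coeff_pow_mul_of_lt {N : R⟦X⟧} (hN : constantCoeff N = 0) (φ : R⟦X⟧) {m l : ℕ}
    (h : m < l) : coeff m (N ^ l * φ) = 0 := by
  rw [pow_eq_shift_pow_mul_X_pow hN, mul_assoc, ← (commute_X_pow φ l).eq, ← mul_assoc,
    coeff_mul_X_pow', if_neg (by omega)]

lemma coeff_pow_mul_self {N : R⟦X⟧} (hN : constantCoeff N = 0) (φ : R⟦X⟧) (m : ℕ) :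
    coeff m (N ^ m * φ) = coeff 1 N ^ m * constantCoeff φ := by
  rw [pow_eq_shift_pow_mul_X_pow hN, mul_assoc, ← (commute_X_pow φ m).eq, ← mul_assoc,
    coeff_mul_X_pow', if_pos le_rfl, Nat.sub_self, coeff_zero_eq_constantCoeff_apply, map_mul,
    map_pow]
  rfl

end Shift

/-- The binomial series `(1 + N)^y = ∑ choose y l N^l` for `N` without constant term. -/
def binomPow (N : R⟦X⟧) (y : ℝ) : R⟦X⟧ :=
  mk fun m => ∑ l ∈ Finset.range (m + 1), Ring.choose y l • coeff m (N ^ l)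

lemma coeff_binomPow_mul {N : R⟦X⟧} (hN : constantCoeff N = 0) (y : ℝ) (φ : R⟦X⟧) (m : ℕ) :
    coeff m (binomPow N y * φ) =
      ∑ l ∈ Finset.range (m + 1), Ring.choose y l • coeff m (N ^ l * φ) := by
  simp_rw [coeff_mul, Finset.smul_sum]
  rw [Finset.sum_comm]
  refine Finset.sum_congr rfl fun p hp => ?_
  have hp : p.1 + p.2 = m := Finset.HasAntidiagonal.mem_antidiagonal.mp hp
  rw [binomPow, coeff_mk, Finset.sum_mul]
  simp_rw [smul_mul_assoc]
  refine Finset.sum_subset (Finset.range_subset_range.mpr (by omega)) fun l _ hl => ?_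
  have h := coeff_pow_mul_of_lt hN 1 (m := p.1) (l := l) (by
    have := Finset.mem_range.not.mp hl; omega)
  rw [mul_one] at h
  rw [h, zero_mul, smul_zero]

lemma binomPow_zero (N : R⟦X⟧) : binomPow N 0 = 1 := by
  ext m
  rw [binomPow, coeff_mk, Finset.sum_range_succ', Finset.sum_eq_zero]
  · simp
  · intro l _
    rw [Ring.choose_zero_succ, zero_smul]

/-- Pascal's rule. Starting from exponent `0`, it identifies the binomial series at all integers,
positive and negative. -/
lemma binomPow_add_one {N : R⟦X⟧} (hN : constantCoeff N = 0) (y : ℝ) :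
    binomPow N (y + 1) = binomPow N y * (1 + N) := by
  ext m
  rw [mul_add, map_add, mul_one, coeff_binomPow_mul hN, binomPow, binomPow, coeff_mk, coeff_mk,
    Finset.sum_range_succ', Finset.sum_range_succ' (fun l => Ring.choose y l • coeff m (N ^ l)),
    Finset.sum_range_succ (fun l => Ring.choose y l • coeff m (N ^ l * N))]
  simp_rw [Ring.choose_succ_succ, add_smul, Finset.sum_add_distrib, ← pow_succ]
  have h := coeff_pow_mul_of_lt hN 1 (m := m) (l := m + 1) (by omega)
  rw [mul_one] at h
  rw [h, smul_zero, Ring.choose_zero_right, Ring.choose_zero_right]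
  abel

lemma binomPow_natCast {N : R⟦X⟧} (hN : constantCoeff N = 0) (i : ℕ) :
    binomPow N i = (1 + N) ^ i := by
  induction i with
  | zero => simp [binomPow_zero]
  | succ i ih => rw [Nat.cast_succ, binomPow_add_one hN, ih, pow_succ]

lemma binomPow_neg_natCast_mul {N : R⟦X⟧} (hN : constantCoeff N = 0) (i : ℕ) :
    binomPow N (-(i : ℝ)) * (1 + N) ^ i = 1 := by
  induction i with
  | zero => simp [binomPow_zero]
  | succ i ih =>
    rw [pow_succ', ← mul_assoc, ← binomPow_add_one hN]
    convert ih using 3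
    push_cast; ring

end PowerSeries

/-! ### Formal order conditions for the multi-product expansion. -/

section Formal
open PowerSeries

/-- The polynomial `choose ((X - 1) / 2) l`. -/
def halfBinom : ℕ → Polynomial ℝ
  | 0 => 1
  | l + 1 => Polynomial.C ((l + 1 : ℝ)⁻¹) * halfBinom l *
      (Polynomial.C (1 / 2) * Polynomial.X - Polynomial.C (1 / 2 + (l : ℝ)))

lemma eval_halfBinom (l : ℕ) (y : ℝ) :
    (halfBinom l).eval y = Ring.choose ((y - 1) / 2) l := by
  induction l with
  | zero => simp [halfBinom]
  | succ l ih =>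
    have h : ∀ n : ℕ, (n.factorial : ℝ) * Ring.choose ((y - 1) / 2) n =
        (descPochhammer ℝ n).eval ((y - 1) / 2) := by
      intro n
      rw [← nsmul_eq_mul, ← Ring.descPochhammer_eq_factorial_smul_choose,
        Polynomial.descPochhammer_smeval_eq_ascPochhammer, descPochhammer_eval_eq_ascPochhammer,
        Polynomial.ascPochhammer_smeval_eq_eval]
    have h1 := h (l + 1)
    rw [descPochhammer_succ_right, Polynomial.eval_mul, ← h l, Nat.factorial_succ] at h1
    have h2 : (l.factorial : ℝ) ≠ 0 := by positivity
    have h3 : (l + 1 : ℝ) ≠ 0 := by positivity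
    simp only [halfBinom, Polynomial.eval_mul, Polynomial.eval_C, Polynomial.eval_sub,
      Polynomial.eval_X, ih]
    simp only [Polynomial.eval_sub, Polynomial.eval_X, Polynomial.eval_natCast] at h1
    push_cast at h1
    have h4 : (l + 1 : ℝ) * Ring.choose ((y - 1) / 2) (l + 1) =
        Ring.choose ((y - 1) / 2) l * ((y - 1) / 2 - l) :=
      mul_left_cancel₀ h2 (by linarith)
    field_simp
    field_simp at h4
    linarith

lemma natDegree_halfBinom_le (l : ℕ) : (halfBinom l).natDegree ≤ l := by
  induction l with
  | zero => simp [halfBinom]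
  | succ l ih =>
    refine Polynomial.natDegree_mul_le.trans (add_le_add ?_ ?_)
    · exact (Polynomial.natDegree_C_mul_le _ _).trans ih
    · compute_degree

lemma coeff_halfBinom_self (l : ℕ) :
    (halfBinom l).coeff l = (1 / 2) ^ l / l.factorial := by
  induction l with
  | zero => simp [halfBinom]
  | succ l ih =>
    have h := Polynomial.coeff_mul_add_eq_of_natDegree_le
      ((Polynomial.natDegree_C_mul_le ((l + 1 : ℝ)⁻¹) _).trans (natDegree_halfBinom_le l))
      (show (Polynomial.C (1 / 2) * Polynomial.X - Polynomial.C (1 / 2 + (l : ℝ))).natDegree ≤ 1 by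
        compute_degree)
    rw [halfBinom, h, Polynomial.coeff_C_mul, ih, Nat.factorial_succ]
    simp only [Polynomial.coeff_sub, Polynomial.coeff_C_mul, Polynomial.coeff_X_one,
      Polynomial.coeff_C_succ]
    push_cast
    field_simp
    ring

variable {R : Type*} [Ring R] [Algebra ℝ R] (A B : R)

/-- The palindromic product `e^A e^{2B} e^A`, without its constant term. -/
def strangTail : R⟦X⟧ := expOf A 1 * expOf B 2 * expOf A 1 - 1

lemma constantCoeff_strangTail : constantCoeff (strangTail A B) = 0 := by
  simp [strangTail]

lemma coeff_one_strangTail : coeff 1 (strangTail A B) = (2 : ℝ) • (A + B) := by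
  simp [strangTail, coeff_mul, Finset.Nat.antidiagonal_succ, coeff_one]
  module

lemma one_add_strangTail : 1 + strangTail A B = expOf A 1 * expOf B 2 * expOf A 1 := by
  simp [strangTail]

/-- Interpolation in `y` of the alternating products with an odd number `y` of factors. -/
def oddPow (y : ℝ) : R⟦X⟧ :=
  binomPow (strangTail A B) ((y - 1) / 2) * (expOf A 1 * expOf B 1)

lemma coeff_oddPow (y : ℝ) (m : ℕ) : coeff m (oddPow A B y) = ∑ l ∈ Finset.range (m + 1),
    (halfBinom l).eval y • coeff m (strangTail A B ^ l * (expOf A 1 * expOf B 1)) := by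
  simp_rw [oddPow, coeff_binomPow_mul (constantCoeff_strangTail A B), eval_halfBinom]

/-- Moving `e^A` to the right through `e^{2B} e^{2A}` turns that factor into the palindrome `e^A
e^{2B} e^A`. -/
lemma oddBasis_expOf {i : ℕ} (hi : 1 ≤ i) :
    oddBasis (expOf A) (expOf B) i 1 = dilate (oddNode i)⁻¹ (oddPow A B (oddNode i)) := by
  obtain ⟨j, rfl⟩ := Nat.exists_eq_add_of_le' hi
  have h1 : (oddNode (j + 1) - 1) / 2 = j := by unfold oddNode; push_cast; ring
  have h2 : SemiconjBy (expOf A 1) (expOf B 2 * expOf A 2) (1 + strangTail A B) := by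
    rw [SemiconjBy, one_add_strangTail, mul_assoc (_ * _), expOf_mul_expOf, one_add_one_eq_two,
      mul_assoc]
  rw [oddPow, h1, binomPow_natCast (constantCoeff_strangTail A B), ← mul_assoc,
    ← (h2.pow_right j).eq]
  simp only [oddBasis, map_mul, map_pow, dilate_expOf, Nat.add_sub_cancel]
  simp only [div_eq_inv_mul, mul_one]

/-- At `-k` the exponent is `-i`. Changing the sign of `X` inverts the palindrome, giving `(1+N)^i
e^{-A} e^{-B}`, and one palindrome absorbs the tail: `e^A e^{2B} e^A e^{-A} e^{-B} = e^A e^B`. -/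
lemma dilate_neg_one_oddPow_neg {i : ℕ} (hi : 1 ≤ i) :
    dilate (-1) (oddPow A B (-oddNode i)) = oddPow A B (oddNode i) := by
  obtain ⟨j, rfl⟩ := Nat.exists_eq_add_of_le' hi
  have hN := constantCoeff_strangTail A B
  have h1 : (oddNode (j + 1) - 1) / 2 = j := by unfold oddNode; push_cast; ring
  have h2 : (-oddNode (j + 1) - 1) / 2 = -((j + 1 : ℕ) : ℝ) := by
    unfold oddNode; push_cast; ring
  have h3 : (1 + strangTail A B) * dilate (-1) (1 + strangTail A B) = 1 := by
    rw [one_add_strangTail]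
    simp only [map_mul, dilate_expOf, mul_assoc]
    rw [← mul_assoc (expOf A 1) (expOf A _), expOf_mul_expOf]
    norm_num [expOf_zero]
    rw [← mul_assoc (expOf B 2), expOf_mul_expOf]
    norm_num [expOf_zero, expOf_mul_expOf]
  have h4 : binomPow (strangTail A B) (-((j + 1 : ℕ) : ℝ)) =
      dilate (-1) (1 + strangTail A B) ^ (j + 1) := by
    refine left_inv_eq_right_inv (binomPow_neg_natCast_mul hN _) ?_
    have h3' : Commute (1 + strangTail A B) (dilate (-1) (1 + strangTail A B)) := by
      have h5 := congrArg (dilate (-1)) h3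
      rw [map_mul, map_one] at h5
      have h6 : dilate (-1) (dilate (-1) (1 + strangTail A B)) = 1 + strangTail A B := by
        ext m; simp [smul_smul, ← mul_pow]
      rw [h6] at h5
      rw [Commute, SemiconjBy, h3, h5]
    rw [← h3'.mul_pow, h3, one_pow]
  have h6 : dilate (-1) (dilate (-1) (1 + strangTail A B)) = 1 + strangTail A B := by
    ext m; simp [smul_smul, ← mul_pow]
  rw [oddPow, oddPow, h1, h2, binomPow_natCast hN, h4]
  simp only [map_mul (dilate (-1)), map_pow, h6, dilate_expOf]
  rw [pow_succ, mul_assoc, one_add_strangTail]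
  congr 1
  have hA : expOf A 1 * expOf A (-1 * 1) = 1 := by rw [expOf_mul_expOf]; norm_num [expOf_zero]
  have hB : expOf B 2 * expOf B (-1 * 1) = expOf B 1 := by rw [expOf_mul_expOf]; norm_num
  rw [mul_assoc (_ * _), ← mul_assoc (expOf A 1) (expOf A _), hA, one_mul, mul_assoc, hB]

/-- Formal order conditions: the multi-product expansion agrees with `e^{A+B}` to order `2n`. -/
theorem coeff_mpeSum_expOf {S : Finset ℕ} (hS : ∀ i ∈ S, 1 ≤ i) {m : ℕ} (hm : m < 2 * S.card) :
    coeff m (mpeSum S (expOf A) (expOf B) 1) = coeff m (expOf (A + B) 1) := by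
  have hk : ∀ i ∈ S, coeff m (oddBasis (expOf A) (expOf B) i 1) =
      ∑ l ∈ Finset.range (m + 1), ((oddNode i)⁻¹ ^ m *
        (((halfBinom l).eval (oddNode i) + (-1) ^ m * (halfBinom l).eval (-oddNode i)) / 2)) •
        coeff m (strangTail A B ^ l * (expOf A 1 * expOf B 1)) := by
    intro i hi
    have h1 := congrArg (coeff m) (dilate_neg_one_oddPow_neg A B (hS i hi))
    -- The coefficient is averaged with its reflection. Parity is thus needed only for the whole sum
    -- at the nodes; the individual polynomials `halfBinom l` have none.
    have h2 : coeff m (oddPow A B (oddNode i)) = (1 / 2 : ℝ) •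
        (coeff m (oddPow A B (oddNode i)) + (-1 : ℝ) ^ m • coeff m (oddPow A B (-oddNode i))) := by
      rw [← coeff_dilate, h1, ← two_smul ℝ, smul_smul]; norm_num
    rw [oddBasis_expOf A B (hS i hi), coeff_dilate, h2, coeff_oddPow, coeff_oddPow,
      Finset.smul_sum, ← Finset.sum_add_distrib, Finset.smul_sum, Finset.smul_sum]
    refine Finset.sum_congr rfl fun l _ => ?_
    module
  have hl : ∀ l ∈ Finset.range (m + 1), _ := fun l hl => sum_mpeCoeff_mul_symm_eval hS hm
    ((natDegree_halfBinom_le l).trans (Nat.lt_succ_iff.mp (Finset.mem_range.mp hl)))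
  rw [mpeSum, map_sum, Finset.sum_congr rfl fun i hi => by rw [coeff_smul, hk i hi]]
  simp_rw [Finset.smul_sum, smul_smul]
  rw [Finset.sum_comm]
  simp_rw [← Finset.sum_smul]
  rw [Finset.sum_congr rfl fun l hl' => by rw [hl l hl'], Finset.sum_range_succ,
    Finset.sum_eq_zero, zero_add, coeff_halfBinom_self,
    coeff_pow_mul_self (constantCoeff_strangTail A B), coeff_one_strangTail, coeff_expOf]
  · have h : constantCoeff (expOf A 1 * expOf B 1) = 1 := by
      simp
    rw [h, mul_one, smul_pow, smul_smul]
    congr 1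
    rw [div_mul_eq_mul_div, ← mul_pow]
    norm_num
  · intro l hl'
    rw [Polynomial.coeff_eq_zero_of_natDegree_lt, zero_smul]
    exact (natDegree_halfBinom_le l).trans_lt (Finset.mem_range.mp hl')

end Formal
end

/-! ### Polynomials in time and their Taylor expansions. -/

noncomputable section

section PolyEval
variable {𝔹 : Type*} [NormedRing 𝔹] [NormedAlgebra ℝ 𝔹]

/-- Evaluation of a polynomial with coefficients in an algebra at a real number. -/
def polyEval (s : ℝ) : Polynomial 𝔹 →ₐ[ℝ] 𝔹 :=
  Polynomial.eval₂AlgHom (AlgHom.id ℝ 𝔹) (algebraMap ℝ 𝔹 s) fun a => (Algebra.commutes s a).symm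

lemma polyEval_monomial (s : ℝ) (n : ℕ) (b : 𝔹) :
    polyEval s (Polynomial.monomial n b) = s ^ n • b := by
  simp [polyEval, Polynomial.eval₂AlgHom, Polynomial.eval₂_monomial, ← map_pow, Algebra.smul_def,
    Algebra.commutes]

lemma hasDerivAt_polyEval (g : Polynomial 𝔹) (s : ℝ) :
    HasDerivAt (fun s => polyEval s g) (polyEval s (Polynomial.derivative g)) s := by
  induction g using Polynomial.induction_on' with
  | add p q hp hq => simpa using hp.fun_add hq
  | monomial n b =>
    simp_rw [Polynomial.derivative_monomial, polyEval_monomial]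
    have h : s ^ (n - 1) • (b * (n : 𝔹)) = (n * s ^ (n - 1)) • b := by
      rw [← nsmul_eq_mul', ← Nat.cast_smul_eq_nsmul ℝ, smul_smul, mul_comm]
    rw [h]
    exact (hasDerivAt_pow n s).smul_const b

lemma continuous_polyEval (g : Polynomial 𝔹) : Continuous fun s : ℝ => polyEval s g :=
  continuous_iff_continuousAt.mpr fun s => (hasDerivAt_polyEval g s).continuousAt

lemma polyEval_isBigO_one (g : Polynomial 𝔹) :
    (fun p : ℝ × ℝ => polyEval p.2 g) =O[𝓝 0] fun _ => (1 : ℝ) :=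
  ((continuous_polyEval g).comp continuous_snd).continuousAt.isBigO_one ℝ

lemma iterate_derivative_monomial {𝔹 : Type*} [Semiring 𝔹] (n j : ℕ) (b : 𝔹) :
    Polynomial.derivative^[j] (Polynomial.monomial n b) =
      Polynomial.monomial (n - j) (n.descFactorial j • b) := by
  induction j with
  | zero => simp
  | succ j ih =>
    rw [Function.iterate_succ_apply', ih, Polynomial.derivative_monomial, Nat.descFactorial_succ,
      ← nsmul_eq_mul', smul_smul, Nat.sub_sub]

lemma pow_fst_isBigO {N k : ℕ} (h : N ≤ k) {f : ℝ × ℝ → 𝔹} (hf : f =O[𝓝 0] fun _ => (1 : ℝ)) :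
    (fun p : ℝ × ℝ => p.1 ^ k • f p) =O[𝓝 0] fun p => p.1 ^ N := by
  have h1 : (fun p : ℝ × ℝ => p.1 ^ (k - N)) =O[𝓝 0] fun _ => (1 : ℝ) :=
    ((continuous_fst.pow _).continuousAt).isBigO_one ℝ
  have h2 := ((Asymptotics.isBigO_refl (fun p : ℝ × ℝ => p.1 ^ N) (𝓝 0)).mul h1).smul hf
  refine (h2.congr_left fun p => ?_).congr_right fun p => by simp
  rw [← pow_add, Nat.add_sub_cancel' h]

lemma polyEval_add_isBigO (N : ℕ) (c : ℝ) (g : Polynomial 𝔹) :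
    (fun p : ℝ × ℝ => polyEval (p.2 + c * p.1) g - ∑ j ∈ Finset.range N,
      p.1 ^ j • ((c ^ j / j.factorial) • polyEval p.2 (Polynomial.derivative^[j] g)))
      =O[𝓝 0] fun p => p.1 ^ N := by
  induction g using Polynomial.induction_on' with
  | add p q hp hq =>
    refine (hp.add hq).congr_left fun x => ?_
    simp only [iterate_map_add, map_add, smul_add, Finset.sum_add_distrib]
    abel
  | monomial n b =>
    have hs : ∀ (p : ℝ × ℝ) (j : ℕ), p.1 ^ j • ((c ^ j / j.factorial) • polyEval p.2
        (Polynomial.derivative^[j] (Polynomial.monomial n b))) =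
        p.1 ^ j • ((c ^ j * n.choose j) • p.2 ^ (n - j) • b) := by
      intro p j
      rw [iterate_derivative_monomial, polyEval_monomial, Nat.descFactorial_eq_factorial_mul_choose,
        ← Nat.cast_smul_eq_nsmul ℝ]
      simp only [smul_smul]
      congr 1
      push_cast
      field_simp
    -- The binomial sum is padded with zero terms up to `N + n + 1`, so that the first `N` terms can
    -- be split off whatever the size of `n`.
    have hbin : ∀ p : ℝ × ℝ, polyEval (p.2 + c * p.1) (Polynomial.monomial n b) =
        ∑ j ∈ Finset.range (N + (n + 1)), p.1 ^ j • ((c ^ j * n.choose j) • p.2 ^ (n - j) • b) := by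
      intro p
      rw [polyEval_monomial, add_comm, add_pow, Finset.sum_smul]
      refine Finset.sum_subset_zero_on_sdiff (Finset.range_subset_range.mpr (by omega)) ?_ ?_
      · intro j hj
        rw [Nat.choose_eq_zero_of_lt]
        · simp
        · simp at hj; omega
      · intro j _
        simp only [smul_smul]
        congr 1
        rw [mul_pow]; ring
    simp_rw [hs, hbin, Finset.sum_range_add _ N (n + 1), add_sub_cancel_left]
    refine Asymptotics.IsBigO.fun_sum fun j _ => ?_
    refine pow_fst_isBigO (Nat.le_add_right N j) ?_
    have hc : Continuous fun p : ℝ × ℝ =>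
        (c ^ (N + j) * (n.choose (N + j) : ℝ)) • p.2 ^ (n - (N + j)) • b := by fun_prop
    exact hc.continuousAt.isBigO_one ℝ

end PolyEval

/-! ### From formal series of operators to asymptotic expansions. -/

section Expansion
variable {𝔹 : Type*} [NormedRing 𝔹] [NormedAlgebra ℝ 𝔹]

/-- Operators on polynomials in time that act from the right. -/
abbrev PolyOp (𝔹 : Type*) [NormedRing 𝔹] [NormedAlgebra ℝ 𝔹] : Type _ :=
  (Module.End ℝ (Polynomial 𝔹))ᵐᵒᵖ

/-- Multiplication by `a` from the right. -/
def polyMul (a : Polynomial 𝔹) : PolyOp 𝔹 := op (LinearMap.mulRight ℝ a)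

/-- The time derivative. -/
def polyDeriv : PolyOp 𝔹 := op (Polynomial.derivative.restrictScalars ℝ)

/-- The truncation to order `N` of the series `1 φ`, at step size `h` and time `s`. -/
def truncEval (N : ℕ) (φ : (PolyOp 𝔹)⟦X⟧) (h s : ℝ) : 𝔹 :=
  ∑ m ∈ Finset.range N, h ^ m • polyEval s ((PowerSeries.coeff m φ).unop 1)

/-- `G h s` has the expansion `1 φ` up to `O(h^N)`, for step sizes and times near `0`. -/
def HasExpansion (N : ℕ) (G : ℝ → ℝ → 𝔹) (φ : (PolyOp 𝔹)⟦X⟧) : Prop :=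
  (fun p : ℝ × ℝ => G p.1 p.2 - truncEval N φ p.1 p.2) =O[𝓝 0] fun p => p.1 ^ N

/-- The right operators `Z h` are represented by the series `ψ` up to `O(h^N)`. -/
def Realizes (N : ℕ) (Z : ℝ → RightOp 𝔹) (ψ : (PolyOp 𝔹)⟦X⟧) : Prop :=
  ∀ G φ, HasExpansion N G φ → HasExpansion N (fun h => RightOp.act (G h) (Z h)) (φ * ψ)

lemma truncEval_isBigO_one (N : ℕ) (φ : (PolyOp 𝔹)⟦X⟧) :
    (fun p : ℝ × ℝ => truncEval N φ p.1 p.2) =O[𝓝 0] fun _ => (1 : ℝ) := by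
  refine Asymptotics.IsBigO.fun_sum fun m _ => ?_
  simpa using pow_fst_isBigO (Nat.zero_le m) (polyEval_isBigO_one _)

lemma RightOp.act_mul (F : ℝ → 𝔹) (X Y : RightOp 𝔹) :
    RightOp.act F (X * Y) = RightOp.act (RightOp.act F X) Y := rfl

lemma Realizes.one (N : ℕ) : Realizes N (fun _ => (1 : RightOp 𝔹)) 1 := by
  intro G φ h
  rw [mul_one]; exact h

lemma Realizes.mul {N : ℕ} {Y Z : ℝ → RightOp 𝔹} {φ ψ : (PolyOp 𝔹)⟦X⟧} (hY : Realizes N Y φ)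
    (hZ : Realizes N Z ψ) : Realizes N (fun h => Y h * Z h) (φ * ψ) := by
  intro G χ h
  rw [← mul_assoc]; exact hZ _ _ (hY _ _ h)

lemma Realizes.pow {N : ℕ} {Z : ℝ → RightOp 𝔹} {ψ : (PolyOp 𝔹)⟦X⟧} (hZ : Realizes N Z ψ) (k : ℕ) :
    Realizes N (fun h => Z h ^ k) (ψ ^ k) := by
  induction k with
  | zero => simpa using Realizes.one N
  | succ k ih => simpa only [pow_succ] using ih.mul hZ

lemma Realizes.oddBasis_family {N : ℕ} {P Q : ℝ → RightOp 𝔹} {p q : ℝ → (PolyOp 𝔹)⟦X⟧}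
    (hP : ∀ c, Realizes N (fun h => P (c * h)) (p c))
    (hQ : ∀ c, Realizes N (fun h => Q (c * h)) (q c)) (i : ℕ) :
    Realizes N (oddBasis P Q i) (oddBasis p q i 1) := by
  have h1 : ∀ h, h / oddNode i = 1 / oddNode i * h := fun h => by ring
  have h2 : ∀ h, 2 * h / oddNode i = 2 * 1 / oddNode i * h := fun h => by ring
  have := ((hP (1 / oddNode i)).mul (((hQ (2 * 1 / oddNode i)).mul
    (hP (2 * 1 / oddNode i))).pow (i - 1))).mul (hQ (1 / oddNode i))
  simp only [← h1, ← h2] at this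
  exact this

lemma HasExpansion.one (N : ℕ) : HasExpansion N (fun _ => (1 : ℝ → 𝔹)) 1 := by
  cases N with
  | zero => simpa [HasExpansion, truncEval] using Asymptotics.isBigO_const_const (1 : 𝔹) (one_ne_zero (α := ℝ)) _
  | succ N =>
    have : ∀ p : ℝ × ℝ, truncEval (𝔹 := 𝔹) (N + 1) 1 p.1 p.2 = 1 := fun p => by
      simp [truncEval, Finset.sum_range_succ', PowerSeries.coeff_one]
    simpa [HasExpansion, this] using Asymptotics.isBigO_zero _ _

lemma HasExpansion.sum {ι : Type*} {N : ℕ} (S : Finset ι) (c : ι → ℝ) {G : ι → ℝ → ℝ → 𝔹}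
    {φ : ι → (PolyOp 𝔹)⟦X⟧} (h : ∀ i ∈ S, HasExpansion N (G i) (φ i)) :
    HasExpansion N (fun h s => ∑ i ∈ S, c i • G i h s) (∑ i ∈ S, c i • φ i) := by
  have := Asymptotics.IsBigO.fun_sum fun i hi => (h i hi).const_smul_left (c i)
  refine this.congr_left fun p => ?_
  simp only [Pi.smul_apply, smul_sub, Finset.sum_sub_distrib, truncEval]
  congr 1
  simp only [Finset.smul_sum, map_sum]
  rw [Finset.sum_comm]
  refine Finset.sum_congr rfl fun m _ => ?_
  simp [Finset.smul_sum, smul_smul, mul_comm, Finset.unop_sum]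

lemma RightOp.act_mpeSum (S : Finset ℕ) (P Q : ℝ → RightOp 𝔹) (F : ℝ → 𝔹) (h s : ℝ) :
    RightOp.act F (mpeSum S P Q h) s =
      ∑ i ∈ S, mpeCoeff S i • RightOp.act F (oddBasis P Q i h) s := by
  simp [RightOp.act, mpeSum, Finset.unop_sum]

lemma HasExpansion.act_mpeSum {N : ℕ} {P Q : ℝ → RightOp 𝔹} {p q : ℝ → (PolyOp 𝔹)⟦X⟧}
    (hP : ∀ c, Realizes N (fun h => P (c * h)) (p c))
    (hQ : ∀ c, Realizes N (fun h => Q (c * h)) (q c)) (S : Finset ℕ) :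
    HasExpansion N (fun h => RightOp.act 1 (mpeSum S P Q h)) (mpeSum S p q 1) := by
  have h := HasExpansion.sum S (mpeCoeff S) fun i _ =>
    Realizes.oddBasis_family hP hQ i _ _ (HasExpansion.one N)
  simp only [one_mul] at h
  simp only [HasExpansion, RightOp.act_mpeSum]
  exact h

/-- The product of two truncations exceeds the truncated Cauchy product only by terms with `i + j ≥
N`. -/
lemma sum_sum_isBigO (N : ℕ) {f : ℕ → ℕ → ℝ × ℝ → 𝔹} (hf : ∀ i j, f i j =O[𝓝 0] fun _ => (1 : ℝ)) :
    (fun p : ℝ × ℝ => ∑ i ∈ Finset.range N, ∑ j ∈ Finset.range N, p.1 ^ (i + j) • f i j p -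
      ∑ m ∈ Finset.range N, p.1 ^ m • ∑ x ∈ Finset.HasAntidiagonal.antidiagonal m, f x.1 x.2 p)
      =O[𝓝 0] fun p => p.1 ^ N := by
  have h : ∀ p : ℝ × ℝ, ∑ m ∈ Finset.range N, p.1 ^ m •
      ∑ x ∈ Finset.HasAntidiagonal.antidiagonal m, f x.1 x.2 p =
      ∑ i ∈ Finset.range N, ∑ j ∈ Finset.range (N - i), p.1 ^ (i + j) • f i j p := by
    intro p
    rw [← Finset.sum_range_diag_flip]
    refine Finset.sum_congr rfl fun m _ => ?_
    rw [← Finset.Nat.sum_antidiagonal_eq_sum_range_succ (fun i j => p.1 ^ (i + j) • f i j p),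
      Finset.smul_sum]
    refine Finset.sum_congr rfl fun x hx => ?_
    rw [Finset.HasAntidiagonal.mem_antidiagonal.mp hx]
  simp_rw [h, ← Finset.sum_sub_distrib]
  refine Asymptotics.IsBigO.fun_sum fun i hi => ?_
  have hi := Finset.mem_range.mp hi
  have h2 : ∀ p : ℝ × ℝ, ∑ j ∈ Finset.range N, p.1 ^ (i + j) • f i j p -
      ∑ j ∈ Finset.range (N - i), p.1 ^ (i + j) • f i j p =
      ∑ j ∈ Finset.range N \ Finset.range (N - i), p.1 ^ (i + j) • f i j p := fun p => by
    rw [sub_eq_iff_eq_add,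
      Finset.sum_sdiff (Finset.range_subset_range.mpr (Nat.sub_le _ _))]
  simp_rw [h2]
  refine Asymptotics.IsBigO.fun_sum fun j hj => pow_fst_isBigO ?_ (hf i j)
  simp at hj; omega

lemma truncEval_mul (N : ℕ) (φ ψ : (PolyOp 𝔹)⟦X⟧) (h s : ℝ) :
    truncEval N (φ * ψ) h s = ∑ m ∈ Finset.range N, h ^ m •
      ∑ x ∈ Finset.HasAntidiagonal.antidiagonal m, polyEval s
        ((PowerSeries.coeff x.2 ψ).unop ((PowerSeries.coeff x.1 φ).unop 1)) := by
  simp [truncEval, PowerSeries.coeff_mul, Finset.unop_sum]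

/-- Taylor's formula applied to each coefficient. The shift moves the time by a multiple of `h`,
which is why expansions are required jointly in `(h, s)` and not at one fixed time. -/
lemma realizes_expShiftOp (N : ℕ) (c : ℝ) :
    Realizes (𝔹 := 𝔹) N (fun h => expShiftOp (c * h)) (PowerSeries.expOf polyDeriv c) := by
  intro G φ hG
  have hcont : Tendsto (fun p : ℝ × ℝ => (p.1, p.2 + c * p.1)) (𝓝 0) (𝓝 0) := by
    have : Continuous fun p : ℝ × ℝ => (p.1, p.2 + c * p.1) := by fun_prop
    simpa only [Prod.fst_zero, Prod.snd_zero, mul_zero, add_zero, Prod.mk_zero_zero] using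
      this.tendsto 0
  have h1 := hG.comp_tendsto hcont
  have h2 := Asymptotics.IsBigO.fun_sum (s := Finset.range N) fun i _ =>
    (pow_fst_isBigO (𝔹 := ℝ) (Nat.zero_le i) (Asymptotics.isBigO_refl _ _)).smul
      (polyEval_add_isBigO N c ((PowerSeries.coeff i φ).unop 1))
  have h3 := sum_sum_isBigO N (f := fun i j p => polyEval p.2
    ((PowerSeries.coeff j (PowerSeries.expOf polyDeriv c)).unop ((PowerSeries.coeff i φ).unop 1)))
    fun i j => polyEval_isBigO_one _
  have h4 : ∀ (g : Polynomial 𝔹) (j : ℕ) (s : ℝ),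
      (c ^ j / j.factorial) • polyEval s (Polynomial.derivative^[j] g) =
      polyEval s ((PowerSeries.coeff j (PowerSeries.expOf polyDeriv c)).unop g) := by
    intro g j s
    rw [PowerSeries.coeff_expOf, unop_smul, unop_pow, LinearMap.smul_apply, map_smul]
    congr 2
    simp only [polyDeriv, unop_op, Module.End.pow_apply]
    rfl
  simp only [smul_eq_mul, pow_zero, one_mul, mul_one] at h2
  refine ((h1.add h2).add h3).congr_left fun p => ?_
  rw [truncEval_mul]
  simp only [Function.comp, truncEval, h4, smul_sub, Finset.sum_sub_distrib, Finset.smul_sum,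
    smul_smul, ← pow_add]
  have h5 : RightOp.act (G p.1) (expShiftOp (c * p.1)) p.2 = G p.1 (p.2 + c * p.1) := rfl
  rw [h5]
  abel

variable [CompleteSpace 𝔹]

lemma exp_sub_sum_isBigO (N : ℕ) (c : ℝ) (a : Polynomial 𝔹) :
    (fun p : ℝ × ℝ => NormedSpace.exp ((c * p.1) • polyEval p.2 a) - ∑ j ∈ Finset.range N,
      p.1 ^ j • ((c ^ j / j.factorial) • polyEval p.2 (a ^ j))) =O[𝓝 0] fun p => p.1 ^ N := by
  have h0 : (fun p : ℝ × ℝ => (c * p.1) • polyEval p.2 a) =O[𝓝 0] fun p => p.1 := by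
    have := (pow_fst_isBigO le_rfl (polyEval_isBigO_one a) (N := 1)).const_smul_left c
    refine (this.congr_left fun p => ?_).congr_right fun p => pow_one _
    simp [smul_smul]
  have h1 : Tendsto (fun p : ℝ × ℝ => (c * p.1) • polyEval p.2 a) (𝓝 0) (𝓝 0) :=
    h0.trans_tendsto (by simpa using (continuous_fst (X := ℝ) (Y := ℝ)).tendsto 0)
  have h2 := ((NormedSpace.exp_hasFPowerSeriesAt_zero (𝕂 := ℝ)
    (𝔸 := 𝔹)).isBigO_sub_partialSum_pow N).comp_tendsto h1
  refine (h2.congr_left fun p => ?_).trans ((h0.norm_left.pow N).congr_left fun p => rfl)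
  simp only [Function.comp, zero_add, FormalMultilinearSeries.partialSum]
  congr 1
  refine Finset.sum_congr rfl fun j _ => ?_
  rw [NormedSpace.expSeries_apply_eq, smul_pow, map_pow, smul_smul, smul_smul, mul_pow]
  congr 1
  ring

lemma realizes_expMulOp (N : ℕ) (c : ℝ) (a : Polynomial 𝔹) :
    Realizes N (fun h => expMulOp (fun s => polyEval s a) (c * h))
      (PowerSeries.expOf (polyMul a) c) := by
  intro G φ hG
  have h1 : (fun p : ℝ × ℝ => NormedSpace.exp ((c * p.1) • polyEval p.2 a))
      =O[𝓝 0] fun _ => (1 : ℝ) := by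
    have hc : Continuous fun p : ℝ × ℝ => NormedSpace.exp ((c * p.1) • polyEval p.2 a) :=
      (continuous_iff_continuousAt.mpr fun x => (NormedSpace.exp_analytic (𝕂 := ℝ) x).continuousAt).comp ((continuous_const.mul continuous_fst).smul
        ((continuous_polyEval a).comp continuous_snd))
    exact hc.continuousAt.isBigO_one ℝ
  have h2 := hG.mul h1
  have h3 := (truncEval_isBigO_one N φ).mul (exp_sub_sum_isBigO N c a)
  have h4 := sum_sum_isBigO N (f := fun i j p => polyEval p.2
    ((PowerSeries.coeff j (PowerSeries.expOf (polyMul a) c)).unop ((PowerSeries.coeff i φ).unop 1)))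
    fun i j => polyEval_isBigO_one _
  have h5 : ∀ (g : Polynomial 𝔹) (j : ℕ) (s : ℝ),
      polyEval s ((PowerSeries.coeff j (PowerSeries.expOf (polyMul a) c)).unop g) =
      polyEval s g * ((c ^ j / j.factorial) • polyEval s (a ^ j)) := by
    intro g j s
    rw [PowerSeries.coeff_expOf, unop_smul, unop_pow, LinearMap.smul_apply, map_smul,
      mul_smul_comm, ← map_mul]
    congr 2
    simp [polyMul, LinearMap.pow_mulRight]
  simp only [one_mul, mul_one] at h2 h3
  refine ((h2.add h3).add h4).congr_left fun p => ?_
  rw [truncEval_mul]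
  have h6 : RightOp.act (G p.1) (expMulOp (fun s => polyEval s a) (c * p.1)) p.2 =
    G p.1 p.2 * NormedSpace.exp ((c * p.1) • polyEval p.2 a) := rfl
  have h7 : ∑ i ∈ Finset.range N, ∑ j ∈ Finset.range N, p.1 ^ (i + j) • polyEval p.2
      ((PowerSeries.coeff j (PowerSeries.expOf (polyMul a) c)).unop
        ((PowerSeries.coeff i φ).unop 1)) = truncEval N φ p.1 p.2 * ∑ j ∈ Finset.range N,
      p.1 ^ j • ((c ^ j / j.factorial) • polyEval p.2 (a ^ j)) := by
    rw [truncEval, Finset.sum_mul_sum]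
    refine Finset.sum_congr rfl fun i _ => Finset.sum_congr rfl fun j _ => ?_
    rw [h5, smul_mul_smul_comm, pow_add]
  simp only [h6, h7]
  noncomm_ring

end Expansion
end

/-! ### Order conditions for realized families; the autonomous case. -/

noncomputable section

section Consistency
variable {𝔹 : Type*} [NormedRing 𝔹] [NormedAlgebra ℝ 𝔹]

/-- Truncated order conditions for operator families that realize formal exponentials. -/
lemma act_mpeSum_sub_truncEval_isBigO {S : Finset ℕ} (hS : ∀ i ∈ S, 1 ≤ i) {P Q : ℝ → RightOp 𝔹}
    {A B : PolyOp 𝔹}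
    (hP : ∀ c, Realizes (2 * S.card) (fun h => P (c * h)) (PowerSeries.expOf A c))
    (hQ : ∀ c, Realizes (2 * S.card) (fun h => Q (c * h)) (PowerSeries.expOf B c)) :
    (fun h => RightOp.act 1 (mpeSum S P Q h) 0 -
      truncEval (2 * S.card) (PowerSeries.expOf (A + B) 1) h 0)
      =O[𝓝 0] fun h : ℝ => h ^ (2 * S.card) := by
  have hc : Tendsto (fun h : ℝ => (h, (0 : ℝ))) (𝓝 0) (𝓝 0) := by
    have : Continuous fun h : ℝ => (h, (0 : ℝ)) := by fun_prop
    simpa only [Prod.mk_zero_zero] using this.tendsto 0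
  refine ((HasExpansion.act_mpeSum hP hQ S).comp_tendsto hc).congr_left fun h => ?_
  simp only [Function.comp, truncEval]
  congr 1
  refine Finset.sum_congr rfl fun m hm => ?_
  rw [coeff_mpeSum_expOf A B hS (Finset.mem_range.mp hm)]

/-- Multiplication from the right by a constant. -/
def constMul (x : 𝔹) : RightOp 𝔹 := op (LinearMap.mulRight ℝ fun _ : ℝ => x)

lemma constMul_mul (x y : 𝔹) : constMul (x * y) = constMul x * constMul y := by
  apply unop_injective
  ext F t
  simp [constMul, mul_assoc]

lemma constMul_one : constMul (1 : 𝔹) = 1 := by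
  apply unop_injective
  ext F t
  simp [constMul]

lemma constMul_pow (x : 𝔹) (k : ℕ) : constMul (x ^ k) = constMul x ^ k := by
  induction k with
  | zero => simp [constMul_one]
  | succ k ih => rw [pow_succ, pow_succ, constMul_mul, ih]

lemma oddBasis_constMul (P Q : ℝ → 𝔹) (i : ℕ) (h : ℝ) :
    oddBasis (fun s => constMul (P s)) (fun s => constMul (Q s)) i h =
      constMul (oddBasis P Q i h) := by
  simp only [oddBasis, constMul_mul, constMul_pow]

lemma act_mpeSum_constMul (S : Finset ℕ) (P Q : ℝ → 𝔹) (h : ℝ) :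
    RightOp.act 1 (mpeSum S (fun s => constMul (P s)) (fun s => constMul (Q s)) h) 0 =
      mpeSum S P Q h := by
  rw [RightOp.act_mpeSum]
  simp only [oddBasis_constMul]
  simp [RightOp.act, constMul, mpeSum]

lemma polyEval_C (s : ℝ) (x : 𝔹) : polyEval s (Polynomial.C x) = x := by
  simpa using polyEval_monomial s 0 x

/-- Consistency of the multi-product expansion for two elements of a Banach algebra. -/
theorem mpeSum_exp_sub_exp_isBigO [CompleteSpace 𝔹] {S : Finset ℕ} (hS : ∀ i ∈ S, 1 ≤ i)
    (A B : 𝔹) :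
    (fun h : ℝ => mpeSum S (fun s => NormedSpace.exp (s • A)) (fun s => NormedSpace.exp (s • B)) h
      - NormedSpace.exp (h • (A + B))) =O[𝓝 0] fun h : ℝ => h ^ (2 * S.card) := by
  have hreal : ∀ (x : 𝔹) (c : ℝ), Realizes (2 * S.card)
      (fun h => constMul (NormedSpace.exp ((c * h) • x)))
      (PowerSeries.expOf (polyMul (Polynomial.C x)) c) := fun x c => by
    simpa only [polyEval_C] using! realizes_expMulOp (2 * S.card) c (Polynomial.C x)
  have h1 := act_mpeSum_sub_truncEval_isBigO hS (P := fun s => constMul (NormedSpace.exp (s • A)))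
    (Q := fun s => constMul (NormedSpace.exp (s • B))) (hreal A) (hreal B)
  have hadd : polyMul (Polynomial.C A) + polyMul (Polynomial.C B) =
      polyMul (Polynomial.C (A + B)) := by
    apply unop_injective
    ext p
    simp [polyMul, mul_add]
  -- The exact exponential is itself realized by the series of `A + B`, so it shares its truncation
  -- with the multi-product sum.
  have h2 := hreal (A + B) 1 _ _ (HasExpansion.one (2 * S.card))
  have hc : Tendsto (fun h : ℝ => (h, (0 : ℝ))) (𝓝 0) (𝓝 0) := by
    have : Continuous fun h : ℝ => (h, (0 : ℝ)) := by fun_prop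
    simpa only [Prod.mk_zero_zero] using this.tendsto 0
  have h3 := h2.comp_tendsto hc
  rw [hadd] at h1
  refine (h1.sub h3).congr_left fun h => ?_
  rw [act_mpeSum_constMul]
  simp [RightOp.act, constMul]

end Consistency

/-! ### Linear differential equations in a Banach algebra. -/

section LinearODE
variable {𝔸 : Type*} [NormedRing 𝔸] [NormedAlgebra ℝ 𝔸]

/-- Being differentiable within a union follows from both pieces, and it is vacuous on a closed
piece that misses `s`. -/
lemma hasDerivWithinAt_Icc_ite {X₁ X₂ v : ℝ → 𝔸} {a b c : ℝ} (hac : a ≤ c) (hcb : c ≤ b)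
    (hX : X₁ c = X₂ c) {s : ℝ}
    (h1 : s ∈ Set.Icc a c → HasDerivWithinAt X₁ (v s) (Set.Icc a c) s)
    (h2 : s ∈ Set.Icc c b → HasDerivWithinAt X₂ (v s) (Set.Icc c b) s) :
    HasDerivWithinAt (fun r => if r ≤ c then X₁ r else X₂ r) (v s) (Set.Icc a b) s := by
  rw [← Set.Icc_union_Icc_eq_Icc hac hcb]
  have e1 : ∀ r ∈ Set.Icc a c, (if r ≤ c then X₁ r else X₂ r) = X₁ r := fun r hr =>
    if_pos hr.2
  have e2 : ∀ r ∈ Set.Icc c b, (if r ≤ c then X₁ r else X₂ r) = X₂ r := fun r hr => by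
    split_ifs with h
    · rw [le_antisymm h hr.1, hX]
    · rfl
  refine HasDerivWithinAt.union ?_ ?_
  · by_cases hs : s ∈ Set.Icc a c
    · exact (h1 hs).congr e1 (e1 s hs)
    · exact HasFDerivWithinAt.of_notMem_closure (by rwa [isClosed_Icc.closure_eq])
  · by_cases hs : s ∈ Set.Icc c b
    · exact (h2 hs).congr e2 (e2 s hs)
    · exact HasFDerivWithinAt.of_notMem_closure (by rwa [isClosed_Icc.closure_eq])

lemma norm_solution_le {A X : ℝ → 𝔸} {a b M : ℝ} (hM : ∀ s ∈ Set.Icc a b, ‖A s‖ ≤ M)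
    (hX : ∀ s ∈ Set.Icc a b, HasDerivWithinAt X (A s * X s) (Set.Icc a b) s) :
    ∀ s ∈ Set.Icc a b, ‖X s‖ ≤ ‖X a‖ * Real.exp (M * (s - a)) := by
  intro s hs
  have h := norm_le_gronwallBound_of_norm_deriv_right_le (f := X) (f' := fun s => A s * X s)
    (δ := ‖X a‖) (K := M) (ε := 0) (fun s hs => (hX s hs).continuousWithinAt)
    (fun s hs => ((hX s ⟨hs.1, hs.2.le⟩).mono_of_mem_nhdsWithin
      (Icc_mem_nhdsGE_of_mem hs))) le_rfl (fun s hs => by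
        rw [add_zero]
        exact (norm_mul_le _ _).trans (mul_le_mul_of_nonneg_right (hM s ⟨hs.1, hs.2.le⟩)
          (norm_nonneg _))) s hs
  rwa [gronwallBound_ε0] at h

variable [CompleteSpace 𝔸]

lemma exists_linear_ode_of_short {A : ℝ → 𝔸} {a b : ℝ} (hab : a ≤ b)
    (hA : ContinuousOn A (Set.Icc a b)) {M : ℝ} (hM : ∀ s ∈ Set.Icc a b, ‖A s‖ ≤ M)
    (hMab : M * (b - a) ≤ 1 / 2) (x₀ : 𝔸) :
    ∃ X : ℝ → 𝔸, X a = x₀ ∧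
      ∀ s ∈ Set.Icc a b, HasDerivWithinAt X (A s * X s) (Set.Icc a b) s := by
  have ha : a ∈ Set.Icc a b := Set.left_mem_Icc.mpr hab
  have hM0 : 0 ≤ M := (norm_nonneg _).trans (hM a ha)
  lift M to NNReal using hM0
  -- On the ball of radius `‖x₀‖ + 1` about `x₀` the field is at most `M (2‖x₀‖ + 1)`; times `b - a`
  -- this is at most `‖x₀‖ + 1/2`.
  have hpl : IsPicardLindelof (fun s x => A s * x) (⟨a, ha⟩ : Set.Icc a b) x₀ (‖x₀‖₊ + 1) 0
      (M * (2 * ‖x₀‖₊ + 1)) M := by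
    refine ⟨fun s hs => ?_, fun x _ => hA.mul continuousOn_const, fun s hs x hx => ?_, ?_⟩
    · refine LipschitzWith.lipschitzOnWith (LipschitzWith.of_dist_le_mul fun x y => ?_)
      rw [dist_eq_norm, dist_eq_norm, ← mul_sub]
      exact (norm_mul_le _ _).trans (mul_le_mul_of_nonneg_right (hM s hs) (norm_nonneg _))
    · have hx' : ‖x‖ ≤ 2 * ‖x₀‖ + 1 := by
        have h1 : ‖x - x₀‖ ≤ ‖x₀‖ + 1 := by simpa [dist_eq_norm] using hx
        have h2 := norm_le_norm_add_norm_sub' x x₀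
        linarith
      push_cast
      exact (norm_mul_le _ _).trans
        (mul_le_mul (hM s hs) hx' (norm_nonneg _) M.coe_nonneg)
    · simp only [sub_self, NNReal.coe_mul, NNReal.coe_add, NNReal.coe_one, NNReal.coe_zero,
        coe_nnnorm, sub_zero, NNReal.coe_ofNat]
      rw [max_eq_left (sub_nonneg.mpr hab)]
      nlinarith [norm_nonneg x₀]
  exact hpl.exists_eq_forall_mem_Icc_hasDerivWithinAt₀

/-- Global existence for linear equations in a Banach algebra on a compact interval. -/
theorem exists_linear_ode {A : ℝ → 𝔸} {a b : ℝ} (hab : a ≤ b)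
    (hA : ContinuousOn A (Set.Icc a b)) (x₀ : 𝔸) :
    ∃ X : ℝ → 𝔸, X a = x₀ ∧
      ∀ s ∈ Set.Icc a b, HasDerivWithinAt X (A s * X s) (Set.Icc a b) s := by
  obtain ⟨M, hM⟩ := isCompact_Icc.exists_bound_of_continuousOn hA
  -- The induction cuts off `1/(k+1)` of the interval: that piece is short enough for
  -- Picard–Lindelöf, and the rest satisfies the bound for `k`.
  obtain ⟨k, hk⟩ := exists_nat_ge (2 * (M * (b - a)))
  replace hk : M * (b - a) ≤ k / 2 := by linarith
  induction k generalizing a x₀ with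
  | zero => exact exists_linear_ode_of_short hab hA hM (hk.trans (by norm_num)) x₀
  | succ k ih =>
    have hk0 : (0 : ℝ) < k + 1 := by positivity
    have hba : 0 ≤ b - a := sub_nonneg.mpr hab
    have hac : a ≤ a + (b - a) / (k + 1) := le_add_of_nonneg_right (by positivity)
    have hcb : a + (b - a) / (k + 1) ≤ b := by
      have : (b - a) / (k + 1) ≤ b - a := div_le_self hba (by linarith [k.cast_nonneg (α := ℝ)])
      linarith
    push_cast at hk
    have hs1 : M * (b - a) / (k + 1) ≤ 1 / 2 := by
      rw [div_le_iff₀ hk0]; linarith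
    obtain ⟨X₁, hX₁a, hX₁⟩ := exists_linear_ode_of_short hac
      (hA.mono (Set.Icc_subset_Icc_right hcb)) (fun s hs => hM s (Set.Icc_subset_Icc_right hcb hs))
      (by calc _ = M * (b - a) / (k + 1) := by ring
            _ ≤ _ := hs1) x₀
    obtain ⟨X₂, hX₂c, hX₂⟩ := ih hcb (hA.mono (Set.Icc_subset_Icc_left hac))
      (X₁ (a + (b - a) / (k + 1))) (fun s hs => hM s (Set.Icc_subset_Icc_left hac hs))
      (by calc _ = M * (b - a) / (k + 1) * k := by field_simp; ring
            _ ≤ 1 / 2 * k := by gcongr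
            _ = _ := by ring)
    set c := a + (b - a) / (k + 1)
    refine ⟨fun r => if r ≤ c then X₁ r else X₂ r, (if_pos hac).trans hX₁a, fun s hs => ?_⟩
    refine hasDerivWithinAt_Icc_ite (v := fun s => A s * if s ≤ c then X₁ s else X₂ s)
      hac hcb hX₂c.symm (fun h => ?_) (fun h => ?_)
    · simpa only [if_pos h.2] using hX₁ s h
    · rcases h.1.eq_or_lt with h' | h'
      · have := hX₂ s h
        rw [← h'] at this ⊢
        simpa only [if_pos le_rfl, ← hX₂c] using this
      · simpa only [if_neg h'.not_ge] using hX₂ s h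

/-- The norm of `1` need not be `1`. Bounding the exponential through its action on `y` keeps powers
of `‖1‖` out of products of arbitrarily many exponentials. -/
lemma norm_exp_mul_le (x y : 𝔸) : ‖NormedSpace.exp x * y‖ ≤ Real.exp ‖x‖ * ‖y‖ := by
  have hpow : ∀ n : ℕ, ‖x ^ n * y‖ ≤ ‖x‖ ^ n * ‖y‖ := fun n => by
    induction n with
    | zero => simp
    | succ n ih =>
      rw [pow_succ', pow_succ', mul_assoc, mul_assoc]
      exact (norm_mul_le _ _).trans (mul_le_mul_of_nonneg_left ih (norm_nonneg _))
  have h1 := (NormedSpace.exp_series_hasSum_exp' (𝕂 := ℝ) x).mul_right y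
  have h2 : HasSum (fun n : ℕ => ‖x‖ ^ n / n.factorial * ‖y‖) (Real.exp ‖x‖ * ‖y‖) := by
    rw [Real.exp_eq_exp_ℝ]
    exact (NormedSpace.expSeries_div_hasSum_exp ‖x‖).mul_right ‖y‖
  refine h1.norm_le_of_bounded h2 fun n => ?_
  rw [smul_mul_assoc, norm_smul, norm_inv, Real.norm_natCast, div_mul_eq_mul_div,
    inv_mul_eq_div]
  gcongr
  exact hpow n

end LinearODE

/-! ### Propagators of the operator products and convergence of Euler products. -/

section EulerProduct
variable {𝔸 : Type*} [NormedRing 𝔸] [NormedAlgebra ℝ 𝔸]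

/-- The ordered product `e^{a A(t+(m-1)b)} ⋯ e^{a A(t+b)} e^{a A(t)}`. -/
def eulerProd (A : ℝ → 𝔸) (a b : ℝ) : ℕ → ℝ → 𝔸
  | 0, _ => 1
  | m + 1, t => eulerProd A a b m (t + b) * NormedSpace.exp (a • A t)

lemma act_expMulOp (A F : ℝ → 𝔸) (a t : ℝ) :
    RightOp.act F (expMulOp A a) t = F t * NormedSpace.exp (a • A t) := rfl

lemma act_expShiftOp (F : ℝ → 𝔸) (a t : ℝ) : RightOp.act F (expShiftOp a) t = F (t + a) := rfl

lemma act_shift_mul_pow (A F : ℝ → 𝔸) (a b : ℝ) (m : ℕ) (t : ℝ) :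
    RightOp.act F ((expShiftOp b * expMulOp A a) ^ m) t =
      F (t + m * b) * eulerProd A a b m t := by
  induction m generalizing t with
  | zero => simp [eulerProd, RightOp.act]
  | succ m ih =>
    rw [pow_succ, RightOp.act_mul, RightOp.act_mul, act_expMulOp, act_expShiftOp, ih, eulerProd,
      mul_assoc]
    congr 2
    push_cast; ring

lemma act_mul_shift_pow (A F : ℝ → 𝔸) (a b : ℝ) (m : ℕ) (t : ℝ) :
    RightOp.act F ((expMulOp A a * expShiftOp b) ^ m) t =
      F (t + m * b) * eulerProd A a b m (t + b) := by
  induction m generalizing t with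
  | zero => simp [eulerProd, RightOp.act]
  | succ m ih =>
    rw [pow_succ, RightOp.act_mul, RightOp.act_mul, act_expShiftOp, act_expMulOp, ih, eulerProd,
      mul_assoc]
    congr 2
    push_cast; ring

/-- The propagator of the `i`-th basis product in which `e^{sA}` is the first factor. -/
def mulShiftProp (A : ℝ → 𝔸) (i : ℕ) (h t : ℝ) : 𝔸 :=
  NormedSpace.exp ((h / oddNode i) • A (t + h)) *
    eulerProd A (2 * h / oddNode i) (2 * h / oddNode i) (i - 1) (t + h / oddNode i)

/-- The propagator of the `i`-th basis product in which `e^{sD}` is the first factor. -/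
def shiftMulProp (A : ℝ → 𝔸) (i : ℕ) (h t : ℝ) : 𝔸 :=
  eulerProd A (2 * h / oddNode i) (2 * h / oddNode i) (i - 1) (t + 2 * h / oddNode i) *
    NormedSpace.exp ((h / oddNode i) • A t)

lemma add_sub_one_mul_div_oddNode {i : ℕ} (hi : 1 ≤ i) (h t : ℝ) :
    t + h / oddNode i + ((i - 1 : ℕ) : ℝ) * (2 * h / oddNode i) = t + h := by
  have hk := (oddNode_pos hi).ne'
  have : ((i - 1 : ℕ) : ℝ) = (oddNode i - 1) / 2 := by
    rw [Nat.cast_sub hi]; unfold oddNode; push_cast; ring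
  rw [this]
  field_simp
  ring

lemma act_oddBasis_mul_shift {i : ℕ} (hi : 1 ≤ i) (A F : ℝ → 𝔸) (h t : ℝ) :
    RightOp.act F (oddBasis (expMulOp A) expShiftOp i h) t = F (t + h) * mulShiftProp A i h t := by
  rw [oddBasis, RightOp.act_mul, RightOp.act_mul, act_expShiftOp, act_shift_mul_pow, act_expMulOp,
    add_sub_one_mul_div_oddNode hi, mulShiftProp, mul_assoc]

lemma act_oddBasis_shift_mul {i : ℕ} (hi : 1 ≤ i) (A F : ℝ → 𝔸) (h t : ℝ) :
    RightOp.act F (oddBasis expShiftOp (expMulOp A) i h) t = F (t + h) * shiftMulProp A i h t := by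
  rw [oddBasis, RightOp.act_mul, RightOp.act_mul, act_expMulOp, act_mul_shift_pow, act_expShiftOp,
    shiftMulProp, mul_assoc]
  congr 2
  rw [← add_sub_one_mul_div_oddNode hi h t]
  ring

variable [CompleteSpace 𝔸]

lemma norm_eulerProd_mul_le {A : ℝ → 𝔸} {M a b : ℝ} (ha : 0 ≤ a) (m : ℕ) {t : ℝ}
    (hM : ∀ j < m, ‖A (t + j * b)‖ ≤ M) (y : 𝔸) :
    ‖eulerProd A a b m t * y‖ ≤ Real.exp (m * (a * M)) * ‖y‖ := by
  induction m generalizing t y with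
  | zero => simp [eulerProd]
  | succ m ih =>
    have h0 : ‖a • A t‖ ≤ a * M := by
      rw [norm_smul, Real.norm_of_nonneg ha]
      have := hM 0 (Nat.succ_pos m)
      rw [Nat.cast_zero, zero_mul, add_zero] at this
      gcongr
    rw [eulerProd, mul_assoc]
    refine (ih (fun j hj => ?_) _).trans ?_
    · convert hM (j + 1) (by omega) using 3
      push_cast; ring
    · calc _ ≤ Real.exp (m * (a * M)) * (Real.exp (a * M) * ‖y‖) := by
            gcongr
            exact (norm_exp_mul_le _ _).trans (by gcongr)
        _ = _ := by
            rw [← mul_assoc, ← Real.exp_add]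
            congr 2
            push_cast; ring

/-- Local error of one step with `A` frozen at the right endpoint: the curve `e^{(t+b-s)A(t+b)}
X(s)` joins the two terms, and its derivative contains only `A(s) - A(t+b)`. -/
lemma norm_solution_sub_exp_mul_le {A X : ℝ → 𝔸} {t b M K ω : ℝ} (hb : 0 ≤ b)
    (hM : ∀ s ∈ Set.Icc t (t + b), ‖A s‖ ≤ M) (hK : ∀ s ∈ Set.Icc t (t + b), ‖X s‖ ≤ K)
    (hω : ∀ s ∈ Set.Icc t (t + b), ‖A s - A (t + b)‖ ≤ ω)
    (hX : ∀ s ∈ Set.Icc t (t + b), HasDerivWithinAt X (A s * X s) (Set.Icc t (t + b)) s) :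
    ‖X (t + b) - NormedSpace.exp (b • A (t + b)) * X t‖ ≤ Real.exp (b * M) * (ω * K) * b := by
  have htb : t ≤ t + b := by linarith
  have hM0 : 0 ≤ M := (norm_nonneg _).trans (hM t (Set.left_mem_Icc.mpr htb))
  have hω0 : 0 ≤ ω := (norm_nonneg _).trans (hω t (Set.left_mem_Icc.mpr htb))
  have hder : ∀ s ∈ Set.Icc t (t + b), HasDerivWithinAt
      (fun s => NormedSpace.exp ((t + b - s) • A (t + b)) * X s)
      (NormedSpace.exp ((t + b - s) • A (t + b)) * ((A s - A (t + b)) * X s))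
      (Set.Icc t (t + b)) s := by
    intro s hs
    have h1 : HasDerivAt (fun s : ℝ => t + b - s) (-1) s := by
      simpa using (hasDerivAt_id s).const_sub (t + b)
    have h2 : HasDerivAt (fun s : ℝ => NormedSpace.exp ((t + b - s) • A (t + b)))
        ((-1 : ℝ) • (NormedSpace.exp ((t + b - s) • A (t + b)) * A (t + b))) s :=
      (hasDerivAt_exp_smul_const (𝕂 := ℝ) (A (t + b)) (t + b - s)).scomp s h1
    refine (h2.hasDerivWithinAt.fun_mul (hX s hs)).congr_deriv ?_
    rw [neg_one_smul]
    noncomm_ring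
  have h := norm_image_sub_le_of_norm_deriv_le_segment' hder
    (C := Real.exp (b * M) * (ω * K)) (fun s hs => ?_) (t + b) (Set.right_mem_Icc.mpr htb)
  · simpa using h
  · have hs' : s ∈ Set.Icc t (t + b) := ⟨hs.1, hs.2.le⟩
    refine (norm_exp_mul_le _ _).trans ?_
    gcongr
    · rw [norm_smul, Real.norm_of_nonneg (by linarith [hs'.2])]
      exact mul_le_mul (by linarith [hs'.1]) (hM _ (Set.right_mem_Icc.mpr htb)) (norm_nonneg _) hb
    · exact (norm_mul_le _ _).trans (mul_le_mul (hω s hs') (hK s hs') (norm_nonneg _) hω0)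

/-- Stability and local error: each of the `m` local errors is carried to the end by an Euler
product, which is bounded by `norm_eulerProd_mul_le`. -/
lemma norm_solution_sub_eulerProd_le {A X : ℝ → 𝔸} {t b M K ω : ℝ} (hb : 0 ≤ b) (m : ℕ)
    (hM : ∀ s ∈ Set.Icc t (t + m * b), ‖A s‖ ≤ M) (hK : ∀ s ∈ Set.Icc t (t + m * b), ‖X s‖ ≤ K)
    (hω : ∀ s ∈ Set.Icc t (t + m * b), ∀ r ∈ Set.Icc t (t + m * b), |s - r| ≤ b →
      ‖A s - A r‖ ≤ ω)
    (hX : ∀ s ∈ Set.Icc t (t + m * b), HasDerivWithinAt X (A s * X s)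
      (Set.Icc t (t + m * b)) s) :
    ‖X (t + m * b) - eulerProd A b b m (t + b) * X t‖ ≤
      m * (Real.exp (m * (b * M)) * (Real.exp (b * M) * (ω * K) * b)) := by
  induction m generalizing t with
  | zero => simp [eulerProd]
  | succ m ih =>
    have hmb : 0 ≤ m * b := by positivity
    have hend : t + ((m + 1 : ℕ) : ℝ) * b = t + b + m * b := by push_cast; ring
    rw [hend] at hM hK hω hX ⊢
    have hsub1 : Set.Icc (t + b) (t + b + m * b) ⊆ Set.Icc t (t + b + m * b) :=
      Set.Icc_subset_Icc_left (by linarith)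
    have hsub2 : Set.Icc t (t + b) ⊆ Set.Icc t (t + b + m * b) :=
      Set.Icc_subset_Icc_right (by linarith)
    have hM0 : 0 ≤ M := (norm_nonneg _).trans (hM t ⟨le_rfl, by linarith⟩)
    have htb : t + b ∈ Set.Icc t (t + b) := ⟨by linarith, le_rfl⟩
    have h1 := ih (t := t + b) (fun s hs => hM s (hsub1 hs)) (fun s hs => hK s (hsub1 hs))
      (fun s hs r hr => hω s (hsub1 hs) r (hsub1 hr)) (fun s hs => (hX s (hsub1 hs)).mono hsub1)
    have h2 := norm_solution_sub_exp_mul_le hb (fun s hs => hM s (hsub2 hs))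
      (fun s hs => hK s (hsub2 hs)) (fun s hs => hω s (hsub2 hs) (t + b) (hsub2 htb)
        (by rw [abs_le]; constructor <;> linarith [hs.1, hs.2]))
      (fun s hs => (hX s (hsub2 hs)).mono hsub2)
    set E := Real.exp (b * M) * (ω * K) * b
    have hE : 0 ≤ E := (norm_nonneg _).trans h2
    have h3 := (norm_eulerProd_mul_le (A := A) (M := M) (b := b) hb m (t := t + b + b)
      (fun j hj => hM _ ⟨by have : 0 ≤ j * b := by positivity
                            linarith, ?_⟩)
      (X (t + b) - NormedSpace.exp (b • A (t + b)) * X t)).trans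
      (mul_le_mul_of_nonneg_left h2 (Real.exp_nonneg _))
    · have hexp : Real.exp (m * (b * M)) ≤ Real.exp (((m + 1 : ℕ) : ℝ) * (b * M)) := by
        gcongr
        simp
      calc _ = ‖(X (t + b + m * b) - eulerProd A b b m (t + b + b) * X (t + b)) +
            eulerProd A b b m (t + b + b) *
              (X (t + b) - NormedSpace.exp (b • A (t + b)) * X t)‖ := by
              rw [eulerProd]; congr 1; noncomm_ring
        _ ≤ m * (Real.exp (m * (b * M)) * E) + Real.exp (m * (b * M)) * E :=
            (norm_add_le _ _).trans (add_le_add h1 h3)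
        _ = (m + 1) * (Real.exp (m * (b * M)) * E) := by ring
        _ ≤ _ := by push_cast at hexp ⊢; gcongr
    · have h4 : ((j : ℝ) + 1) ≤ m := by exact_mod_cast hj
      nlinarith

/-- Euler products converge to the solution of the linear equation. -/
theorem tendsto_eulerProd {A X : ℝ → 𝔸} {t h : ℝ} (hh : 0 ≤ h)
    (hA : ContinuousOn A (Set.Icc t (t + h))) (hXt : X t = 1)
    (hX : ∀ s ∈ Set.Icc t (t + h), HasDerivWithinAt X (A s * X s) (Set.Icc t (t + h)) s) :
    Tendsto (fun N : ℕ => eulerProd A (h / N) (h / N) N (t + h / N)) atTop (𝓝 (X (t + h))) := by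
  obtain ⟨M, hM⟩ := isCompact_Icc.exists_bound_of_continuousOn hA
  obtain ⟨K, hK⟩ := isCompact_Icc.exists_bound_of_continuousOn
    (fun s hs => (hX s hs).continuousWithinAt)
  have ht : t ∈ Set.Icc t (t + h) := ⟨le_rfl, by linarith⟩
  have hM0 : 0 ≤ M := (norm_nonneg _).trans (hM t ht)
  have hK0 : 0 ≤ K := (norm_nonneg _).trans (hK t ht)
  have huc := isCompact_Icc.uniformContinuousOn_of_continuous hA
  rw [Metric.uniformContinuousOn_iff_le] at huc
  rw [Metric.tendsto_atTop']
  intro ε hε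
  -- `R - 1` multiplies the modulus of continuity in the global error; the `+ 1` keeps the divisor
  -- positive when `h` or `K` vanishes.
  set R := Real.exp (h * M) * (Real.exp (h * M) * K * h) + 1
  have hR : 0 < R := by positivity
  obtain ⟨δ, hδ, hω⟩ := huc (ε / (2 * R)) (by positivity)
  obtain ⟨N₀, hN₀⟩ := exists_nat_gt (h / δ)
  refine ⟨N₀, fun N hN => ?_⟩
  have hNpos : (0 : ℝ) < N := by exact_mod_cast (Nat.zero_le N₀).trans_lt hN
  have hb : 0 ≤ h / N := by positivity
  have hNb : (N : ℝ) * (h / N) = h := by field_simp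
  have hbδ : h / N ≤ δ := by
    have : (N₀ : ℝ) < N := by exact_mod_cast hN
    rw [div_lt_iff₀ hδ] at hN₀
    rw [div_le_iff₀ hNpos]
    nlinarith
  have hbh : h / N ≤ h := div_le_self hh (by exact_mod_cast Nat.one_le_iff_ne_zero.mpr (by omega))
  have key := norm_solution_sub_eulerProd_le (A := A) (X := X) (t := t) (M := M) (K := K)
    (ω := ε / (2 * R)) hb N
  rw [hNb, hXt, mul_one] at key
  rw [dist_comm, dist_eq_norm]
  refine (key hM hK (fun s hs r hr hsr => ?_) hX).trans_lt ?_
  · have := hω s hs r hr ((Real.dist_eq s r).trans_le (hsr.trans hbδ))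
    rwa [dist_eq_norm] at this
  · calc _ = Real.exp (N * (h / N) * M) * (Real.exp (h / N * M) * (ε / (2 * R) * K) *
          (N * (h / N))) := by rw [mul_assoc (N : ℝ)]; ring
      _ ≤ Real.exp (h * M) * (Real.exp (h * M) * (ε / (2 * R) * K) * h) := by
          rw [hNb]; gcongr
      _ = ε / (2 * R) * (R - 1) := by simp only [R]; ring
      _ ≤ ε / (2 * R) * R := by gcongr; linarith
      _ = ε / 2 := by field_simp
      _ < ε := half_lt_self hε

end EulerProduct
end

/-! ### The truncated formal flow against the true solution. -/

noncomputable section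

section Flow
variable {𝔹 : Type*} [NormedRing 𝔹] [NormedAlgebra ℝ 𝔹]

/-- The formal solution `1 e^{h(a+D)}`. -/
def formalFlow (a : Polynomial 𝔹) : (PolyOp 𝔹)⟦X⟧ := PowerSeries.expOf (polyMul a + polyDeriv) 1

/-- Coefficient form of `∂_h u = u a + ∂_s u`. It makes the derivative of `u(h - r, r)` telescope,
leaving only a top-order residual. -/
lemma coeff_formalFlow_succ (a : Polynomial 𝔹) (m : ℕ) :
    ((m + 1 : ℕ) : ℝ) • (PowerSeries.coeff (m + 1) (formalFlow a)).unop 1 =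
      (PowerSeries.coeff m (formalFlow a)).unop 1 * a +
        Polynomial.derivative ((PowerSeries.coeff m (formalFlow a)).unop 1) := by
  have h : (((m + 1 : ℕ) : ℝ) * (1 / ((m + 1).factorial : ℝ))) = 1 / m.factorial := by
    rw [Nat.factorial_succ]
    push_cast
    field_simp
  simp only [formalFlow, PowerSeries.coeff_expOf, one_pow, unop_smul, LinearMap.smul_apply,
    smul_smul, h]
  simp only [pow_succ, unop_mul, Module.End.mul_apply]
  simp only [polyMul, polyDeriv, unop_add, unop_op, LinearMap.add_apply, LinearMap.mulRight_apply,
    LinearMap.restrictScalars_apply, smul_mul_assoc, smul_add, Polynomial.derivative_smul]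

lemma truncEval_succ (N : ℕ) (φ : (PolyOp 𝔹)⟦X⟧) (h s : ℝ) :
    truncEval (N + 1) φ h s =
      truncEval N φ h s + h ^ N • polyEval s ((PowerSeries.coeff N φ).unop 1) := by
  rw [truncEval, truncEval, Finset.sum_range_succ]

/-- The truncated formal flow satisfies the backward equation up to the order of truncation. -/
lemma hasDerivAt_truncEval_formalFlow (a : Polynomial 𝔹) (M : ℕ) (h r : ℝ) :
    HasDerivAt (fun r => truncEval (M + 1) (formalFlow a) (h - r) r)
      (-(truncEval (M + 1) (formalFlow a) (h - r) r * polyEval r a) + (h - r) ^ M •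
        polyEval r (((M + 1 : ℕ) : ℝ) • (PowerSeries.coeff (M + 1) (formalFlow a)).unop 1)) r := by
  have hpow : ∀ m : ℕ, HasDerivAt (fun r : ℝ => (h - r) ^ (m + 1))
      (-(((m + 1 : ℕ) : ℝ) * (h - r) ^ m)) r := fun m => by
    have := ((hasDerivAt_id r).const_sub h).fun_pow (m + 1)
    simpa using this
  simp only [coeff_formalFlow_succ, map_add, map_mul]
  induction M with
  | zero =>
    have h0 : (PowerSeries.coeff 0 (formalFlow a)).unop 1 = 1 := by
      simp [formalFlow]
    simp only [truncEval, zero_add, Finset.sum_range_one, pow_zero, one_smul, h0, map_one]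
    simpa using hasDerivAt_const r (1 : 𝔹)
  | succ M ih =>
    have h1 := (hpow M).fun_smul (hasDerivAt_polyEval
      ((PowerSeries.coeff (M + 1) (formalFlow a)).unop 1) r)
    have h2 := ih.fun_add h1
    simp only [truncEval_succ (M + 1)]
    refine h2.congr_deriv ?_
    have h3 := congrArg (polyEval r) (coeff_formalFlow_succ a M)
    rw [map_smul, map_add, map_mul] at h3
    rw [← h3, add_mul, smul_mul_assoc]
    module

lemma truncEval_formalFlow_zero (a : Polynomial 𝔹) (M : ℕ) (s : ℝ) :
    truncEval (M + 1) (formalFlow a) 0 s = 1 := by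
  simp [truncEval, Finset.sum_range_succ', formalFlow]

lemma continuous_truncEval (N : ℕ) (φ : (PolyOp 𝔹)⟦X⟧) :
    Continuous fun p : ℝ × ℝ => truncEval N φ p.1 p.2 :=
  continuous_finsetSum _ fun _ _ =>
    (continuous_fst.pow _).smul ((continuous_polyEval _).comp continuous_snd)

/-- The truncated formal flow of a polynomial close to `A` approximates the solution of
`X' = A X`. -/
lemma exists_norm_solution_sub_truncEval_le (a : Polynomial 𝔹) (M : ℕ) :
    ∃ C : ℝ, 0 ≤ C ∧ ∀ {𝔸 : Type*} [NormedRing 𝔸] [NormedAlgebra ℝ 𝔸] (ε : 𝔹 →ₐ[ℝ] 𝔸)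
      (_ : ∀ x, ‖ε x‖ ≤ ‖x‖) (A X : ℝ → 𝔸) (h K L : ℝ), 0 ≤ h → h ≤ 1 → 0 ≤ L →
      (∀ r ∈ Set.Icc 0 h, HasDerivWithinAt X (A r * X r) (Set.Icc 0 h) r) →
      (∀ r ∈ Set.Icc 0 h, ‖X r‖ ≤ K) →
      (∀ r ∈ Set.Icc 0 h, ‖A r - ε (polyEval r a)‖ ≤ L * r ^ M) →
      ‖X h - ε (truncEval (M + 1) (formalFlow a) h 0) * X 0‖ ≤ C * (L + 1) * K * h ^ (M + 1) := by
  obtain ⟨U, hU⟩ := (isCompact_Icc (a := ((0, 0) : ℝ × ℝ)) (b := (1, 1))).exists_bound_of_continuousOn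
    (continuous_truncEval (M + 1) (formalFlow a)).continuousOn
  obtain ⟨E, hE⟩ := (isCompact_Icc (a := (0 : ℝ)) (b := 1)).exists_bound_of_continuousOn
    (continuous_polyEval
      (((M + 1 : ℕ) : ℝ) • (PowerSeries.coeff (M + 1) (formalFlow a)).unop 1)).continuousOn
  have hU0 : 0 ≤ U := (norm_nonneg _).trans (hU (0, 0) ⟨le_rfl, by simp [Prod.le_def]⟩)
  have hE0 : 0 ≤ E := (norm_nonneg _).trans (hE 0 ⟨le_rfl, zero_le_one⟩)
  -- `U` bounds the truncated flow and `E` its residual, both in `𝔹`; the constant is therefore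
  -- chosen before `ε` and does not depend on it.
  refine ⟨U + E, by positivity, ?_⟩
  intro 𝔸 _ _ ε hε A X h K L hh hh1 hL hX hK hA
  have hK0 : 0 ≤ K := (norm_nonneg _).trans (hK 0 ⟨le_rfl, hh⟩)
  set u : ℝ → 𝔹 := fun r => truncEval (M + 1) (formalFlow a) (h - r) r
  set e : ℝ → 𝔹 := fun r => polyEval r
    (((M + 1 : ℕ) : ℝ) • (PowerSeries.coeff (M + 1) (formalFlow a)).unop 1)
  have hεu : ∀ r, HasDerivAt (fun r => ε (u r))
      (-(ε (u r) * ε (polyEval r a)) + (h - r) ^ M • ε (e r)) r := fun r => by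
    have := (ε.toLinearMap.mkContinuous 1 fun x => by simpa using hε x).hasFDerivAt.comp_hasDerivAt
      r (hasDerivAt_truncEval_formalFlow a M h r)
    refine this.congr_deriv ?_
    simp [u, e]
  have hder : ∀ r ∈ Set.Icc 0 h, HasDerivWithinAt (fun r => ε (u r) * X r)
      (ε (u r) * ((A r - ε (polyEval r a)) * X r) + (h - r) ^ M • (ε (e r) * X r))
      (Set.Icc 0 h) r := fun r hr => by
    refine ((hεu r).hasDerivWithinAt.fun_mul (hX r hr)).congr_deriv ?_
    rw [add_mul, smul_mul_assoc]
    noncomm_ring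
  have hbound : ∀ r ∈ Set.Ico 0 h,
      ‖ε (u r) * ((A r - ε (polyEval r a)) * X r) + (h - r) ^ M • (ε (e r) * X r)‖ ≤
        (U + E) * (L + 1) * K * h ^ M := by
    intro r hr
    have hr' : r ∈ Set.Icc 0 h := ⟨hr.1, hr.2.le⟩
    have hu : ‖ε (u r)‖ ≤ U := (hε _).trans
      (hU (h - r, r) ⟨⟨by linarith [hr.2], hr.1⟩, ⟨by linarith [hr.1], by linarith [hr.2]⟩⟩)
    have he : ‖ε (e r)‖ ≤ E := (hε _).trans (hE r ⟨hr.1, by linarith [hr.2]⟩)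
    have hrM : r ^ M ≤ h ^ M := pow_le_pow_left₀ hr.1 hr.2.le M
    have hhrM : (h - r) ^ M ≤ h ^ M :=
      pow_le_pow_left₀ (by linarith [hr.2]) (by linarith [hr.1]) M
    have hhr0 : 0 ≤ (h - r) ^ M := pow_nonneg (by linarith [hr.2]) M
    have h1 : ‖ε (u r) * ((A r - ε (polyEval r a)) * X r)‖ ≤ U * (L * h ^ M * K) := by
      refine (norm_mul_le _ _).trans (mul_le_mul hu ?_ (norm_nonneg _) hU0)
      refine (norm_mul_le _ _).trans (mul_le_mul ?_ (hK r hr') (norm_nonneg _) (by positivity))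
      exact (hA r hr').trans (by gcongr)
    have h2 : ‖(h - r) ^ M • (ε (e r) * X r)‖ ≤ h ^ M * (E * K) := by
      rw [norm_smul, Real.norm_of_nonneg hhr0]
      refine mul_le_mul hhrM ?_ (norm_nonneg _) (by positivity)
      exact (norm_mul_le _ _).trans (mul_le_mul he (hK r hr') (norm_nonneg _) hE0)
    refine (norm_add_le _ _).trans ((add_le_add h1 h2).trans ?_)
    have h3 : 0 ≤ h ^ M * K := by positivity
    nlinarith [mul_nonneg hU0 h3, mul_nonneg (mul_nonneg hE0 hL) h3]
  have h4 := norm_image_sub_le_of_norm_deriv_le_segment' hder hbound h ⟨hh, le_rfl⟩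
  -- The curve `ε(u(r)) X(r)` runs from the approximation at `r = 0` to `X h` at `r = h`.
  have huh : u h = 1 := by simp only [u, sub_self, truncEval_formalFlow_zero]
  have hu0 : u 0 = truncEval (M + 1) (formalFlow a) h 0 := by simp only [u, sub_zero]
  rw [huh, hu0, map_one, one_mul, sub_zero] at h4
  exact h4.trans_eq (by ring)

end Flow

/-! ### Uniform Taylor remainder. -/

section Taylor
variable {E : Type*} [NormedAddCommGroup E] [NormedSpace ℝ E]

/-- Taylor's theorem to the right of an arbitrary point of a compact interval, uniformly. -/
lemma exists_norm_sub_taylorWithinEval_le {f : ℝ → E} {a b : ℝ} {n : ℕ} (hab : a < b)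
    (hf : ContDiffOn ℝ (n + 1) f (Set.Icc a b)) :
    ∃ L : ℝ, 0 ≤ L ∧ ∀ t ∈ Set.Icc a b, ∀ x ∈ Set.Icc t b,
      ‖f x - taylorWithinEval f n (Set.Icc a b) t x‖ ≤ L * (x - t) ^ (n + 1) := by
  obtain ⟨C, hC⟩ := isCompact_Icc.exists_bound_of_continuousOn
    (hf.continuousOn_iteratedDerivWithin le_rfl (uniqueDiffOn_Icc hab))
  have hC0 : 0 ≤ C := (norm_nonneg _).trans (hC a ⟨le_rfl, hab.le⟩)
  refine ⟨(n.factorial : ℝ)⁻¹ * C, by positivity, fun t ht x hx => ?_⟩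
  have hsub : Set.Icc t x ⊆ Set.Icc a b := Set.Icc_subset_Icc ht.1 hx.2
  have hf' : DifferentiableOn ℝ (iteratedDerivWithin n f (Set.Icc a b)) (Set.Icc a b) :=
    hf.differentiableOn_iteratedDerivWithin (mod_cast n.lt_succ_self) (uniqueDiffOn_Icc hab)
  -- The Taylor polynomial is differentiated in its base point, where the derivative collapses to a
  -- single term of top order.
  have hder : ∀ y ∈ Set.Icc t x, HasDerivWithinAt
      (fun y => taylorWithinEval f n (Set.Icc a b) y x)
      (((n.factorial : ℝ)⁻¹ * (x - y) ^ n) • iteratedDerivWithin (n + 1) f (Set.Icc a b) y)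
      (Set.Icc t x) y := fun y hy =>
    (hasDerivWithinAt_taylorWithinEval_at_Icc x hab (hsub hy) hf.of_succ hf').mono hsub
  have h := norm_image_sub_le_of_norm_deriv_le_segment' hder
    (C := (n.factorial : ℝ)⁻¹ * (x - t) ^ n * C) (fun y hy => ?_) x ⟨hx.1, le_rfl⟩
  · rw [taylorWithinEval_self] at h
    exact h.trans_eq (by ring)
  · have h0 : 0 ≤ (x - y) ^ n := pow_nonneg (by linarith [hy.2]) n
    rw [norm_smul, Real.norm_of_nonneg (by positivity)]
    have h1 : (x - y) ^ n ≤ (x - t) ^ n :=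
      pow_le_pow_left₀ (by linarith [hy.2]) (by linarith [hy.1]) n
    have h2 := hC y (hsub ⟨hy.1, hy.2.le⟩)
    have h3 : 0 ≤ (x - t) ^ n := h0.trans h1
    gcongr

end Taylor

/-! ### Lipschitz dependence of the propagators on the coefficient function. -/

section Propagators

lemma norm_mul_sub_mul_le {𝔸 : Type*} [NormedRing 𝔸] {x x' y y' : 𝔸} {b c d e : ℝ} (hx : ‖x - x'‖ ≤ b) (hy : ‖y‖ ≤ c)
    (hx' : ‖x'‖ ≤ d) (hyy : ‖y - y'‖ ≤ e) : ‖x * y - x' * y'‖ ≤ b * c + d * e := by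
  have hb : 0 ≤ b := (norm_nonneg _).trans hx
  have hd : 0 ≤ d := (norm_nonneg _).trans hx'
  calc ‖x * y - x' * y'‖ = ‖(x - x') * y + x' * (y - y')‖ := by congr 1; noncomm_ring
    _ ≤ _ := (norm_add_le _ _).trans (add_le_add
      ((norm_mul_le _ _).trans (mul_le_mul hx hy (norm_nonneg _) hb))
      ((norm_mul_le _ _).trans (mul_le_mul hx' hyy (norm_nonneg _) hd)))

variable {𝔸 : Type*} [NormedRing 𝔸] [NormedAlgebra ℝ 𝔸]

lemma eulerProd_add (A : ℝ → 𝔸) (a b t : ℝ) (m : ℕ) (s : ℝ) :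
    eulerProd A a b m (t + s) = eulerProd (fun r => A (t + r)) a b m s := by
  induction m generalizing s with
  | zero => rfl
  | succ m ih => rw [eulerProd, eulerProd, ← ih, add_assoc]

lemma mulShiftProp_eq_zero_time (A : ℝ → 𝔸) (i : ℕ) (h t : ℝ) :
    mulShiftProp A i h t = mulShiftProp (fun r => A (t + r)) i h 0 := by
  simp only [mulShiftProp, eulerProd_add A, zero_add]

lemma shiftMulProp_eq_zero_time (A : ℝ → 𝔸) (i : ℕ) (h t : ℝ) :
    shiftMulProp A i h t = shiftMulProp (fun r => A (t + r)) i h 0 := by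
  simp only [shiftMulProp, eulerProd_add A, zero_add, add_zero]

variable [CompleteSpace 𝔸]

lemma norm_exp_le (x : 𝔸) : ‖NormedSpace.exp x‖ ≤ Real.exp ‖x‖ * ‖(1 : 𝔸)‖ := by
  simpa using norm_exp_mul_le x 1

/-- Mean value inequality along `e^{(1-s)x} e^{sy}`; no commutation of `x` and `y` is needed. -/
lemma norm_exp_sub_exp_le (x y : 𝔸) : ‖NormedSpace.exp x - NormedSpace.exp y‖ ≤
    Real.exp ‖x‖ * (‖x - y‖ * (Real.exp ‖y‖ * ‖(1 : 𝔸)‖)) := by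
  have hder : ∀ s ∈ Set.Icc (0 : ℝ) 1, HasDerivWithinAt
      (fun s : ℝ => NormedSpace.exp ((1 - s) • x) * NormedSpace.exp (s • y))
      (NormedSpace.exp ((1 - s) • x) * ((y - x) * NormedSpace.exp (s • y))) (Set.Icc 0 1) s := by
    intro s _
    have h1 : HasDerivAt (fun s : ℝ => 1 - s) (-1) s := by
      simpa using (hasDerivAt_id s).const_sub 1
    have h2 : HasDerivAt (fun s : ℝ => NormedSpace.exp ((1 - s) • x))
        ((-1 : ℝ) • (NormedSpace.exp ((1 - s) • x) * x)) s :=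
      (hasDerivAt_exp_smul_const (𝕂 := ℝ) x (1 - s)).scomp s h1
    refine (h2.fun_mul (hasDerivAt_exp_smul_const' (𝕂 := ℝ) y s)).hasDerivWithinAt.congr_deriv ?_
    rw [neg_one_smul]
    noncomm_ring
  have h := norm_image_sub_le_of_norm_deriv_le_segment_01' hder
    (C := Real.exp ‖x‖ * (‖x - y‖ * (Real.exp ‖y‖ * ‖(1 : 𝔸)‖))) fun s hs => by
      refine (norm_exp_mul_le _ _).trans ?_
      have hx : ‖(1 - s) • x‖ ≤ ‖x‖ := by
        rw [norm_smul, Real.norm_of_nonneg (by linarith [hs.2])]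
        exact mul_le_of_le_one_left (norm_nonneg _) (by linarith [hs.1])
      have hy : ‖s • y‖ ≤ ‖y‖ := by
        rw [norm_smul, Real.norm_of_nonneg hs.1]
        exact mul_le_of_le_one_left (norm_nonneg _) hs.2.le
      gcongr
      refine (norm_mul_le _ _).trans ?_
      rw [norm_sub_rev]
      gcongr
      exact (norm_exp_le _).trans (by gcongr)
  rw [norm_sub_rev]
  simpa using h

lemma norm_exp_smul_le {x : 𝔸} {a M : ℝ} (ha : a ∈ Set.Icc (0 : ℝ) 2) (hx : ‖x‖ ≤ M) :
    ‖NormedSpace.exp (a • x)‖ ≤ Real.exp (2 * M) * ‖(1 : 𝔸)‖ := by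
  refine (norm_exp_le _).trans ?_
  gcongr
  rw [norm_smul, Real.norm_of_nonneg ha.1]
  exact mul_le_mul ha.2 hx (norm_nonneg _) (by norm_num)

lemma norm_exp_smul_sub_le {x y : 𝔸} {a M δ : ℝ} (ha : a ∈ Set.Icc (0 : ℝ) 2) (hx : ‖x‖ ≤ M)
    (hy : ‖y‖ ≤ M) (hxy : ‖x - y‖ ≤ δ) :
    ‖NormedSpace.exp (a • x) - NormedSpace.exp (a • y)‖ ≤
      Real.exp (2 * M) * (Real.exp (2 * M) * ‖(1 : 𝔸)‖) * (a * δ) := by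
  have h : ∀ z : 𝔸, ‖z‖ ≤ M → ‖a • z‖ ≤ 2 * M := fun z hz => by
    rw [norm_smul, Real.norm_of_nonneg ha.1]
    exact mul_le_mul ha.2 hz (norm_nonneg _) (by norm_num)
  calc _ ≤ Real.exp (2 * M) * ((a * δ) * (Real.exp (2 * M) * ‖(1 : 𝔸)‖)) := by
        refine (norm_exp_sub_exp_le _ _).trans ?_
        have h1 := h x hx
        have h2 := h y hy
        have h3 : ‖a • x - a • y‖ ≤ a * δ := by
          rw [← smul_sub, norm_smul, Real.norm_of_nonneg ha.1]
          exact mul_le_mul_of_nonneg_left hxy ha.1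
        have h4 : 0 ≤ a * δ := (norm_nonneg _).trans h3
        gcongr
    _ = _ := by ring

lemma norm_eulerProd_le {A : ℝ → 𝔸} {M a b : ℝ} (ha : a ∈ Set.Icc (0 : ℝ) 2) (hM0 : 0 ≤ M) (m : ℕ)
    {t : ℝ} (hM : ∀ j < m, ‖A (t + j * b)‖ ≤ M) :
    ‖eulerProd A a b m t‖ ≤ Real.exp (m * (2 * M)) * ‖(1 : 𝔸)‖ := by
  have h := norm_eulerProd_mul_le ha.1 m hM 1
  rw [mul_one] at h
  refine h.trans ?_
  gcongr
  exact ha.2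

variable (𝔸) in
lemma exists_norm_eulerProd_sub_le {M : ℝ} (hM0 : 0 ≤ M) (m : ℕ) :
    ∃ C : ℝ, 0 ≤ C ∧ ∀ (A A' : ℝ → 𝔸) (a b t δ : ℝ), a ∈ Set.Icc (0 : ℝ) 2 →
      (∀ j < m, ‖A (t + j * b)‖ ≤ M) → (∀ j < m, ‖A' (t + j * b)‖ ≤ M) →
      (∀ j < m, ‖A (t + j * b) - A' (t + j * b)‖ ≤ δ) →
      ‖eulerProd A a b m t - eulerProd A' a b m t‖ ≤ C * (a * δ) := by
  induction m with
  | zero => exact ⟨0, le_rfl, fun A A' a b t δ _ _ _ _ => by simp [eulerProd]⟩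
  | succ m ih =>
    obtain ⟨C, hC0, hC⟩ := ih
    refine ⟨C * (Real.exp (2 * M) * ‖(1 : 𝔸)‖) + Real.exp (m * (2 * M)) * ‖(1 : 𝔸)‖ *
      (Real.exp (2 * M) * (Real.exp (2 * M) * ‖(1 : 𝔸)‖)), by positivity,
      fun A A' a b t δ ha hA hA' hδ => ?_⟩
    have hshift : ∀ j : ℕ, t + b + j * b = t + ((j + 1 : ℕ) : ℝ) * b := fun j => by
      push_cast; ring
    have h0 : t + ((0 : ℕ) : ℝ) * b = t := by simp
    have h1 := hC A A' a b (t + b) δ ha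
      (fun j hj => by rw [hshift]; exact hA _ (by omega))
      (fun j hj => by rw [hshift]; exact hA' _ (by omega))
      (fun j hj => by rw [hshift]; exact hδ _ (by omega))
    have h2 := norm_eulerProd_le (A := A') (b := b) ha hM0 m (t := t + b)
      (fun j hj => by rw [hshift]; exact hA' _ (by omega))
    have hA0 := hA 0 (Nat.succ_pos m)
    have hA0' := hA' 0 (Nat.succ_pos m)
    have hδ0 := hδ 0 (Nat.succ_pos m)
    rw [h0] at hA0 hA0' hδ0
    refine (norm_mul_sub_mul_le h1 (norm_exp_smul_le ha hA0) h2
      (norm_exp_smul_sub_le ha hA0 hA0' hδ0)).trans_eq ?_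
    ring

lemma div_oddNode_mem_Icc {i : ℕ} (hi : 1 ≤ i) {c h : ℝ} (hc : c ∈ Set.Icc 0 (oddNode i))
    (hh : 0 ≤ h) : c * h / oddNode i ∈ Set.Icc 0 h := by
  have hk := oddNode_pos hi
  have hc0 := hc.1
  refine ⟨by positivity, ?_⟩
  rw [div_le_iff₀ hk, mul_comm h]
  exact mul_le_mul_of_nonneg_right hc.2 hh

lemma one_le_oddNode {i : ℕ} (hi : 1 ≤ i) : 1 ≤ oddNode i := by
  have : (1 : ℝ) ≤ i := by exact_mod_cast hi
  unfold oddNode; linarith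

lemma step_bounds {i : ℕ} (hi : 1 ≤ i) {h : ℝ} (hh : h ∈ Set.Icc (0 : ℝ) 1) :
    h / oddNode i ∈ Set.Icc (0 : ℝ) 2 ∧ 2 * h / oddNode i ∈ Set.Icc (0 : ℝ) 2 ∧
      h / oddNode i ≤ h ∧ 2 * h / oddNode i ≤ 2 * h := by
  have hk := oddNode_pos hi
  have h0 := hh.1
  have h1 : h / oddNode i ≤ h := div_le_self hh.1 (one_le_oddNode hi)
  have h2 : 2 * h / oddNode i ≤ 2 * h := div_le_self (by linarith) (one_le_oddNode hi)
  exact ⟨⟨by positivity, by linarith [hh.2]⟩, ⟨by positivity, by linarith [hh.2]⟩, h1, h2⟩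

-- Every exponent carries a step length proportional to `h`, so a perturbation `δ` of the
-- coefficient costs only `hδ`. This supplies the last power of `h`.
variable (𝔸) in
lemma exists_norm_prop_sub_le {M : ℝ} (hM0 : 0 ≤ M) {i : ℕ} (hi : 1 ≤ i) :
    ∃ C : ℝ, 0 ≤ C ∧ ∀ (A A' : ℝ → 𝔸) (h δ : ℝ), h ∈ Set.Icc (0 : ℝ) 1 →
      (∀ r ∈ Set.Icc 0 h, ‖A r‖ ≤ M) → (∀ r ∈ Set.Icc 0 h, ‖A' r‖ ≤ M) →
      (∀ r ∈ Set.Icc 0 h, ‖A r - A' r‖ ≤ δ) →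
      ‖mulShiftProp A i h 0 - mulShiftProp A' i h 0‖ ≤ C * (h * δ) ∧
      ‖shiftMulProp A i h 0 - shiftMulProp A' i h 0‖ ≤ C * (h * δ) := by
  obtain ⟨C, hC0, hC⟩ := exists_norm_eulerProd_sub_le 𝔸 hM0 (i - 1)
  refine ⟨Real.exp (2 * M) * (Real.exp (2 * M) * ‖(1 : 𝔸)‖) *
      (Real.exp ((i - 1 : ℕ) * (2 * M)) * ‖(1 : 𝔸)‖) +
      Real.exp (2 * M) * ‖(1 : 𝔸)‖ * (C * 2), by positivity, fun A A' h δ hh hA hA' hδ => ?_⟩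
  have hδ0 : 0 ≤ δ := (norm_nonneg _).trans (hδ 0 ⟨le_rfl, hh.1⟩)
  have hh0 := hh.1
  obtain ⟨ha1, ha2, hb1, hb2⟩ := step_bounds hi hh
  have hj : ∀ j < i - 1, (2 * (j : ℝ) + 2) ≤ oddNode i - 1 := fun j hj => by
    have : ((j + 2 : ℕ) : ℝ) ≤ i := by exact_mod_cast (by omega)
    push_cast at this
    unfold oddNode; linarith
  have hp1 : ∀ j < i - 1, 0 + h / oddNode i + (j : ℝ) * (2 * h / oddNode i) ∈ Set.Icc 0 h :=
    fun j hji => by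
      have := div_oddNode_mem_Icc hi (c := 2 * j + 1) ⟨by positivity, by linarith [hj j hji]⟩ hh.1
      convert this using 1
      ring
  have hp2 : ∀ j < i - 1, 0 + 2 * h / oddNode i + (j : ℝ) * (2 * h / oddNode i) ∈ Set.Icc 0 h :=
    fun j hji => by
      have := div_oddNode_mem_Icc hi (c := 2 * j + 2) ⟨by positivity, by linarith [hj j hji]⟩ hh.1
      convert this using 1
      ring
  have hmem0 : (0 : ℝ) ∈ Set.Icc 0 h := ⟨le_rfl, hh.1⟩
  have hmemh : 0 + h ∈ Set.Icc 0 h := by rw [zero_add]; exact ⟨hh.1, le_rfl⟩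
  have hfac1 : Real.exp (2 * M) * (Real.exp (2 * M) * ‖(1 : 𝔸)‖) * (h / oddNode i * δ) ≤
      Real.exp (2 * M) * (Real.exp (2 * M) * ‖(1 : 𝔸)‖) * (h * δ) := by gcongr
  have hfac2 : C * (2 * h / oddNode i * δ) ≤ C * (2 * h * δ) := by gcongr
  constructor
  · refine (norm_mul_sub_mul_le
      ((norm_exp_smul_sub_le ha1 (hA _ hmemh) (hA' _ hmemh) (hδ _ hmemh)).trans hfac1)
      (norm_eulerProd_le ha2 hM0 (i - 1) fun j hj => hA _ (hp1 j hj))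
      (norm_exp_smul_le ha1 (hA' _ hmemh))
      ((hC A A' _ _ _ δ ha2 (fun j hj => hA _ (hp1 j hj)) (fun j hj => hA' _ (hp1 j hj))
        fun j hj => hδ _ (hp1 j hj)).trans hfac2)).trans_eq ?_
    ring
  · refine (norm_mul_sub_mul_le
      ((hC A A' _ _ _ δ ha2 (fun j hj => hA _ (hp2 j hj)) (fun j hj => hA' _ (hp2 j hj))
        fun j hj => hδ _ (hp2 j hj)).trans hfac2) (norm_exp_smul_le ha1 (hA _ hmem0))
      (norm_eulerProd_le ha2 hM0 (i - 1) fun j hj => hA' _ (hp2 j hj))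
      ((norm_exp_smul_sub_le ha1 (hA _ hmem0) (hA' _ hmem0) (hδ _ hmem0)).trans hfac1)).trans_eq ?_
    ring

end Propagators

/-! ### Propagators commute with contractive algebra homomorphisms. -/

section Naturality
variable {𝔸 : Type*} [NormedRing 𝔸] [NormedAlgebra ℝ 𝔸]
variable {𝔹 : Type*} [NormedRing 𝔹] [NormedAlgebra ℝ 𝔹] [CompleteSpace 𝔹]

lemma map_exp_of_norm_le (ε : 𝔹 →ₐ[ℝ] 𝔸) (hε : ∀ x, ‖ε x‖ ≤ ‖x‖) (x : 𝔹) :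
    ε (NormedSpace.exp x) = NormedSpace.exp (ε x) := by
  have hc : Continuous ε :=
    (ε.toLinearMap.mkContinuous 1 fun x => by simpa using hε x).continuous
  exact NormedSpace.map_exp_of_mem_ball (𝕂 := ℝ) ε hc x
    ((NormedSpace.expSeries_radius_eq_top ℝ 𝔹).symm ▸ edist_lt_top _ _)

lemma map_eulerProd (ε : 𝔹 →ₐ[ℝ] 𝔸) (hε : ∀ x, ‖ε x‖ ≤ ‖x‖) (A : ℝ → 𝔹) (a b : ℝ) (m : ℕ)
    (t : ℝ) : ε (eulerProd A a b m t) = eulerProd (fun r => ε (A r)) a b m t := by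
  induction m generalizing t with
  | zero => simp [eulerProd]
  | succ m ih => rw [eulerProd, map_mul, ih, map_exp_of_norm_le ε hε, map_smul, eulerProd]

lemma map_mulShiftProp (ε : 𝔹 →ₐ[ℝ] 𝔸) (hε : ∀ x, ‖ε x‖ ≤ ‖x‖) (A : ℝ → 𝔹) (i : ℕ) (h t : ℝ) :
    ε (mulShiftProp A i h t) = mulShiftProp (fun r => ε (A r)) i h t := by
  rw [mulShiftProp, map_mul, map_eulerProd ε hε, map_exp_of_norm_le ε hε, map_smul, mulShiftProp]

lemma map_shiftMulProp (ε : 𝔹 →ₐ[ℝ] 𝔸) (hε : ∀ x, ‖ε x‖ ≤ ‖x‖) (A : ℝ → 𝔹) (i : ℕ) (h t : ℝ) :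
    ε (shiftMulProp A i h t) = shiftMulProp (fun r => ε (A r)) i h t := by
  rw [shiftMulProp, map_mul, map_eulerProd ε hε, map_exp_of_norm_le ε hε, map_smul, shiftMulProp]

end Naturality
end

/-! ### Consistency for the non-autonomous equation. -/

noncomputable section

section Nonautonomous
variable {𝔸 : Type*} [NormedRing 𝔸] [NormedAlgebra ℝ 𝔸]

lemma tendsto_act_expAddD [CompleteSpace 𝔸] {A X : ℝ → 𝔸} {t h : ℝ} (hh : 0 ≤ h)
    (hA : ContinuousOn A (Set.Icc t (t + h))) (hXt : X t = 1)
    (hX : ∀ s ∈ Set.Icc t (t + h), HasDerivWithinAt X (A s * X s) (Set.Icc t (t + h)) s)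
    (F : ℝ → 𝔸) :
    Tendsto (fun N : ℕ => RightOp.act F ((expMulOp A (h / N) * expShiftOp (h / N)) ^ N) t) atTop
      (𝓝 (F (t + h) * X (t + h))) := by
  refine ((tendsto_eulerProd hh hA hXt hX).const_mul (F (t + h))).congr' ?_
  filter_upwards [eventually_ge_atTop 1] with N hN
  have hN' : (N : ℝ) ≠ 0 := by positivity
  rw [act_mul_shift_pow, mul_div_cancel₀ _ hN']

lemma norm_sum_smul_sub_le {S : Finset ℕ} {c C : ℕ → ℝ} {p q : ℕ → 𝔸} {Y Z : 𝔸} {C₂ C₃ e : ℝ}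
    (h1 : ∀ i ∈ S, ‖p i - q i‖ ≤ C i * e) (h2 : ‖∑ i ∈ S, c i • q i - Y‖ ≤ C₂ * e)
    (h3 : ‖Z - Y‖ ≤ C₃ * e) :
    ‖∑ i ∈ S, c i • p i - Z‖ ≤ (∑ i ∈ S, |c i| * C i + C₂ + C₃) * e := by
  have h4 : ‖∑ i ∈ S, c i • (p i - q i)‖ ≤ (∑ i ∈ S, |c i| * C i) * e := by
    rw [Finset.sum_mul]
    refine norm_sum_le_of_le _ fun i hi => ?_
    rw [norm_smul, Real.norm_eq_abs, mul_assoc]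
    exact mul_le_mul_of_nonneg_left (h1 i hi) (abs_nonneg _)
  have h5 : ∑ i ∈ S, c i • p i - Z =
      ∑ i ∈ S, c i • (p i - q i) + (∑ i ∈ S, c i • q i - Y) - (Z - Y) := by
    simp only [smul_sub, Finset.sum_sub_distrib]
    abel
  rw [h5]
  refine (norm_sub_le _ _).trans ((add_le_add (norm_add_le _ _) le_rfl).trans ?_)
  linarith

/-- Evaluation of continuous functions with values in a noncommutative algebra. -/
def evalAtHom {ι : Type*} [TopologicalSpace ι] (x : ι) : C(ι, 𝔸) →ₐ[ℝ] 𝔸 where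
  toFun f := f x
  map_one' := rfl
  map_mul' _ _ := rfl
  map_zero' := rfl
  map_add' _ _ := rfl
  commutes' _ := rfl

/-- A polynomial with coefficients in `C([0, T], 𝔸)` whose values are the Taylor polynomials of `A`
at the points of `[0, T]`. -/
lemma exists_polynomial_taylor {A : ℝ → 𝔸} {T : ℝ} (hT : 0 < T) {n : ℕ}
    (hA : ContDiffOn ℝ (n + 1) A (Set.Icc 0 T)) :
    ∃ a : Polynomial C(Set.Icc 0 T, 𝔸), ∀ (t : Set.Icc 0 T) (r : ℝ),
      polyEval r a t = taylorWithinEval A n (Set.Icc 0 T) t (t + r) := by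
  have hcont : ∀ j : ℕ, j < n + 1 → ContinuousOn
      (fun t => (j.factorial : ℝ)⁻¹ • iteratedDerivWithin j A (Set.Icc 0 T) t) (Set.Icc 0 T) :=
    fun j hj => (hA.continuousOn_iteratedDerivWithin (by exact_mod_cast hj.le)
      (uniqueDiffOn_Icc hT)).const_smul _
  refine ⟨∑ j : Fin (n + 1), Polynomial.monomial (j : ℕ)
    ⟨_, (hcont j j.2).domRestrict⟩, fun t r => ?_⟩
  rw [taylor_within_apply, map_sum, ← Fin.sum_univ_eq_sum_range
    (fun k => ((k.factorial : ℝ)⁻¹ * ((t : ℝ) + r - t) ^ k) •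
      iteratedDerivWithin k A (Set.Icc 0 T) t), ContinuousMap.sum_apply]
  refine Finset.sum_congr rfl fun j _ => ?_
  rw [polyEval_monomial, ContinuousMap.smul_apply, ContinuousMap.coe_mk, Set.domRestrict_apply,
    smul_smul, add_sub_cancel_left, mul_comm]

variable [CompleteSpace 𝔸]

/-- Consistency of the propagators of the multi-product expansion with the exact propagator. -/
theorem exists_norm_sum_prop_sub_solution_le {S : Finset ℕ} (hS : ∀ i ∈ S, 1 ≤ i) {n : ℕ}
    (hSn : S.card = n + 1) {T : ℝ} (hT : 0 < T) {A : ℝ → 𝔸}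
    (hA : ContDiffOn ℝ ((2 * n : ℕ) + 1) A (Set.Icc 0 T)) :
    ∃ C h₀ : ℝ, 0 < h₀ ∧ ∀ (h t : ℝ) (X : ℝ → 𝔸), 0 ≤ h → h ≤ h₀ → 0 ≤ t → t + h ≤ T →
      X t = 1 →
      (∀ s ∈ Set.Icc t (t + h), HasDerivWithinAt X (A s * X s) (Set.Icc t (t + h)) s) →
      ‖∑ i ∈ S, mpeCoeff S i • mulShiftProp A i h t - X (t + h)‖ ≤ C * h ^ (2 * (n + 1)) ∧
      ‖∑ i ∈ S, mpeCoeff S i • shiftMulProp A i h t - X (t + h)‖ ≤ C * h ^ (2 * (n + 1)) := by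
  obtain ⟨a, ha⟩ := exists_polynomial_taylor hT hA
  obtain ⟨L, hL0, hL⟩ := exists_norm_sub_taylorWithinEval_le hT hA
  obtain ⟨M₁, hM₁⟩ := isCompact_Icc.exists_bound_of_continuousOn hA.continuousOn
  obtain ⟨M₂, hM₂⟩ := (isCompact_Icc (a := (0 : ℝ)) (b := 1)).exists_bound_of_continuousOn
    (continuous_polyEval a).continuousOn
  have hM₁0 : 0 ≤ M₁ := (norm_nonneg _).trans (hM₁ 0 ⟨le_rfl, hT.le⟩)
  have hP := fun i (hi : i ∈ S) => exists_norm_prop_sub_le 𝔸 (le_max_of_le_left hM₁0 : 0 ≤ max M₁ M₂)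
    (hS i hi)
  choose! C₁ hC₁0 hC₁ using hP
  obtain ⟨C₃, hC₃0, hC₃⟩ := exists_norm_solution_sub_truncEval_le a (2 * n + 1)
  have hmul := realizes_expMulOp (2 * S.card) (a := a)
  have hshift := realizes_expShiftOp (𝔹 := C(Set.Icc 0 T, 𝔸)) (2 * S.card)
  have hO1 := act_mpeSum_sub_truncEval_isBigO hS (fun c => hmul c) hshift
  have hO2 := act_mpeSum_sub_truncEval_isBigO hS hshift (fun c => hmul c)
  -- Both orders of the factors have the same formal limit, since only the sum of the two generators
  -- enters.
  rw [add_comm polyDeriv] at hO2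
  obtain ⟨C₂, hC₂⟩ := hO1.bound
  obtain ⟨C₂', hC₂'⟩ := hO2.bound
  obtain ⟨δ, hδ, hball⟩ := Metric.eventually_nhds_iff.mp (hC₂.and hC₂')
  set K := ‖(1 : 𝔸)‖ * Real.exp (M₁ * T)
  -- The three summands: replacing `A` by its Taylor polynomial in the propagators, the order
  -- conditions for that polynomial, and the truncated flow against `X`. The bound `1` on `h₀`
  -- serves the estimates made on `[0, 1]`; `δ/2` keeps `h` strictly inside the ball.
  refine ⟨∑ i ∈ S, |mpeCoeff S i| * (C₁ i * L) + max C₂ C₂' + C₃ * (L + 1) * K,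
    min 1 (δ / 2), by positivity, ?_⟩
  intro h t X hh0 hh ht hthT hXt hX
  have hh1 : h ≤ 1 := hh.trans (min_le_left _ _)
  have hhδ : dist h 0 < δ := by
    rw [dist_zero_right, Real.norm_of_nonneg hh0]
    linarith [hh.trans (min_le_right _ _)]
  have htT : t ∈ Set.Icc 0 T := ⟨ht, by linarith⟩
  set ε : C(Set.Icc 0 T, 𝔸) →ₐ[ℝ] 𝔸 := evalAtHom ⟨t, htT⟩
  have hε : ∀ x, ‖ε x‖ ≤ ‖x‖ := fun x => x.norm_coe_le_norm ⟨t, htT⟩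
  have hsub : ∀ r ∈ Set.Icc 0 h, t + r ∈ Set.Icc t (t + h) := fun r hr =>
    ⟨by linarith [hr.1], by linarith [hr.2]⟩
  have hsubT : ∀ r ∈ Set.Icc 0 h, t + r ∈ Set.Icc 0 T := fun r hr =>
    ⟨by linarith [hr.1], by linarith [hr.2]⟩
  have hTay : ∀ r ∈ Set.Icc 0 h, ‖A (t + r) - ε (polyEval r a)‖ ≤ L * r ^ (2 * n + 1) := by
    intro r hr
    have h1 := hL t htT (t + r) ⟨by linarith [hr.1], (hsubT r hr).2⟩
    rw [add_sub_cancel_left] at h1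
    have h2 : ε (polyEval r a) = taylorWithinEval A (2 * n) (Set.Icc 0 T) t (t + r) :=
      ha ⟨t, htT⟩ r
    rwa [h2]
  have hTay' : ∀ r ∈ Set.Icc 0 h, ‖A (t + r) - ε (polyEval r a)‖ ≤ L * h ^ (2 * n + 1) :=
    fun r hr => (hTay r hr).trans (mul_le_mul_of_nonneg_left
      (pow_le_pow_left₀ hr.1 hr.2 _) hL0)
  have hp : ∀ i ∈ S, _ := fun i hi => hC₁ i hi (fun r => A (t + r)) (fun r => ε (polyEval r a)) h
    (L * h ^ (2 * n + 1)) ⟨hh0, hh1⟩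
    (fun r hr => (hM₁ _ (hsubT r hr)).trans (le_max_left _ _))
    (fun r hr => ((hε _).trans (hM₂ r ⟨hr.1, hr.2.trans hh1⟩)).trans (le_max_right _ _)) hTay'
  have hpow : h * (L * h ^ (2 * n + 1)) = L * h ^ (2 * (n + 1)) := by ring
  have hX' : ∀ r ∈ Set.Icc 0 h, HasDerivWithinAt (fun r => X (t + r)) (A (t + r) * X (t + r))
      (Set.Icc 0 h) r := by
    intro r hr
    have h1 : HasDerivWithinAt (fun r : ℝ => t + r) 1 (Set.Icc 0 h) r :=
      ((hasDerivAt_id r).const_add t).hasDerivWithinAt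
    simpa using! (hX (t + r) (hsub r hr)).scomp r h1 hsub
  have hK : ∀ r ∈ Set.Icc 0 h, ‖X (t + r)‖ ≤ K := by
    intro r hr
    have h1 := norm_solution_le (fun s hs => hM₁ s ⟨by linarith [hs.1], by linarith [hs.2]⟩) hX
      (t + r) (hsub r hr)
    rw [hXt, add_sub_cancel_left] at h1
    refine h1.trans ?_
    have : r ≤ T := by linarith [hr.2]
    simp only [K]
    gcongr
  have h3 := hC₃ ε hε (fun r => A (t + r)) (fun r => X (t + r)) h K L hh0 hh1 hL0 hX' hK hTay
  simp only [add_zero, hXt, mul_one] at h3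
  have hcard : 2 * S.card = 2 * n + 1 + 1 := by omega
  have hb := hball hhδ
  have hnorm : ‖h ^ (2 * S.card)‖ = h ^ (2 * (n + 1)) := by
    rw [Real.norm_of_nonneg (by positivity), hSn]
  have hq1 : ∑ i ∈ S, mpeCoeff S i • mulShiftProp (fun r => ε (polyEval r a)) i h 0 =
      ε (RightOp.act 1 (mpeSum S (expMulOp fun r => polyEval r a) expShiftOp h) 0) := by
    rw [RightOp.act_mpeSum, map_sum]
    refine Finset.sum_congr rfl fun i hi => ?_
    rw [act_oddBasis_mul_shift (hS i hi), map_smul, Pi.one_apply, one_mul, map_mulShiftProp ε hε]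
  have hq2 : ∑ i ∈ S, mpeCoeff S i • shiftMulProp (fun r => ε (polyEval r a)) i h 0 =
      ε (RightOp.act 1 (mpeSum S expShiftOp (expMulOp fun r => polyEval r a) h) 0) := by
    rw [RightOp.act_mpeSum, map_sum]
    refine Finset.sum_congr rfl fun i hi => ?_
    rw [act_oddBasis_shift_mul (hS i hi), map_smul, Pi.one_apply, one_mul, map_shiftMulProp ε hε]
  have hepos : 0 ≤ h ^ (2 * (n + 1)) := by positivity
  rw [hnorm, hcard] at hb
  constructor
  · refine norm_sum_smul_sub_le (q := fun i => mulShiftProp (fun r => ε (polyEval r a)) i h 0)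
      (fun i hi => ?_) (Y := ε (truncEval (2 * n + 1 + 1) (formalFlow a) h 0)) ?_ h3
    · rw [mulShiftProp_eq_zero_time, mul_assoc, ← hpow]
      exact (hp i hi).1
    · rw [hq1, ← map_sub]
      exact (hε _).trans (hb.1.trans (mul_le_mul_of_nonneg_right (le_max_left _ _) hepos))
  · refine norm_sum_smul_sub_le (q := fun i => shiftMulProp (fun r => ε (polyEval r a)) i h 0)
      (fun i hi => ?_) (Y := ε (truncEval (2 * n + 1 + 1) (formalFlow a) h 0)) ?_ h3
    · rw [shiftMulProp_eq_zero_time, mul_assoc, ← hpow]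
      exact (hp i hi).2
    · rw [hq2, ← map_sub]
      exact (hε _).trans (hb.2.trans (mul_le_mul_of_nonneg_right (le_max_right _ _) hepos))

end Nonautonomous
end

theorem mainTheorem4 {𝔸 : Type*} [NormedRing 𝔸] [NormedAlgebra ℝ 𝔸] [CompleteSpace 𝔸]
    (n : ℕ) (hn : 1 ≤ n) (S : Finset ℕ) (hS : ∀ i ∈ S, 1 ≤ i) (hSn : S.card = n) :
    -- the coefficients are the solution of the Vandermonde system
    (∀ c : ℕ → ℝ, SolvesVandermonde S c ↔ ∀ i ∈ S, c i = mpeCoeff S i) ∧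
    -- two operators `A`, `B`
    (∀ A B : 𝔸,
      (fun h : ℝ =>
        mpeSum S (fun s => NormedSpace.exp (s • A)) (fun s => NormedSpace.exp (s • B)) h
          - NormedSpace.exp (h • (A + B)))
        =O[nhds 0] fun h : ℝ => h ^ (2 * n)) ∧
    -- the non-autonomous equation `Y' = A(t) Y`, with `B = D`
    (∀ (T : ℝ), 0 < T → ∀ A : ℝ → 𝔸,
      ContDiffOn ℝ ((2 * n - 1 : ℕ) : ℕ∞) A (Set.Icc 0 T) →
      -- `exp(h(A + D))` exists
      (∀ (h t : ℝ), 0 ≤ h → 0 ≤ t → t + h ≤ T → ∀ F : ℝ → 𝔸,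
        Filter.Tendsto
          (fun N : ℕ => RightOp.act F ((expMulOp A (h / N) * expShiftOp (h / N)) ^ N) t)
          Filter.atTop (nhds (expAddD A h F t))) ∧
      -- and, applied to `1`, is the solution operator of the equation
      (∀ t ∈ Set.Icc 0 T, expAddD A 0 1 t = 1 ∧
        ∀ s ∈ Set.Icc t T,
          HasDerivWithinAt (fun r => expAddD A (r - t) 1 t) (A s * expAddD A (s - t) 1 t)
            (Set.Icc t T) s) ∧
      -- consistency in operator norm, for both orders of the factors `A` and `D`
      (∃ C h₀ : ℝ, 0 < h₀ ∧ ∀ (h t : ℝ), 0 ≤ h → h ≤ h₀ → 0 ≤ t → t + h ≤ T →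
        ∀ (F : ℝ → 𝔸) (K : ℝ), (∀ s ∈ Set.Icc 0 T, ‖F s‖ ≤ K) →
          ‖RightOp.act F (mpeSum S (expMulOp A) expShiftOp h) t - expAddD A h F t‖
              ≤ C * h ^ (2 * n) * K ∧
          ‖RightOp.act F (mpeSum S expShiftOp (expMulOp A) h) t - expAddD A h F t‖
              ≤ C * h ^ (2 * n) * K)) := by
  refine ⟨solvesVandermonde_iff hS, fun A B => hSn ▸ mpeSum_exp_sub_exp_isBigO hS A B, ?_⟩
  intro T hT A hA
  have hAc := hA.continuousOn
  -- Stated for all real `t`, with the zero function as a dummy outside `[0, T]`, so that solutions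
  -- can be chosen as a function of `t` alone.
  have hsol : ∀ t : ℝ, ∃ X : ℝ → 𝔸, t ∈ Set.Icc 0 T → X t = 1 ∧
      ∀ s ∈ Set.Icc t T, HasDerivWithinAt X (A s * X s) (Set.Icc t T) s := fun t => by
    by_cases ht : t ∈ Set.Icc 0 T
    · obtain ⟨X, hX⟩ := exists_linear_ode ht.2 (hAc.mono (Set.Icc_subset_Icc_left ht.1)) 1
      exact ⟨X, fun _ => hX⟩
    · exact ⟨0, fun h => absurd h ht⟩
  choose X hX using hsol
  have hX' : ∀ h t : ℝ, 0 ≤ h → 0 ≤ t → t + h ≤ T → X t t = 1 ∧ ∀ s ∈ Set.Icc t (t + h),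
      HasDerivWithinAt (X t) (A s * X t s) (Set.Icc t (t + h)) s := fun h t hh ht hth => by
    have h1 := hX t ⟨ht, by linarith⟩
    have h2 : Set.Icc t (t + h) ⊆ Set.Icc t T := Set.Icc_subset_Icc_right hth
    exact ⟨h1.1, fun s hs => (h1.2 s (h2 hs)).mono h2⟩
  have hlim : ∀ h t : ℝ, 0 ≤ h → 0 ≤ t → t + h ≤ T → ∀ F : ℝ → 𝔸, Filter.Tendsto
      (fun N : ℕ => RightOp.act F ((expMulOp A (h / N) * expShiftOp (h / N)) ^ N) t)
      Filter.atTop (nhds (F (t + h) * X t (t + h))) := fun h t hh ht hth F =>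
    tendsto_act_expAddD hh (hAc.mono (Set.Icc_subset_Icc ht hth)) (hX' h t hh ht hth).1
      (hX' h t hh ht hth).2 F
  have hexp : ∀ h t : ℝ, 0 ≤ h → 0 ≤ t → t + h ≤ T → ∀ F : ℝ → 𝔸,
      expAddD A h F t = F (t + h) * X t (t + h) := fun h t hh ht hth F =>
    (hlim h t hh ht hth F).limUnder_eq
  refine ⟨fun h t hh ht hth F => ?_, fun t ht => ⟨?_, fun s hs => ?_⟩, ?_⟩
  · rw [hexp h t hh ht hth F]
    exact hlim h t hh ht hth F
  · rw [hexp 0 t le_rfl ht.1 (by linarith [ht.2]), add_zero, (hX t ht).1, Pi.one_apply, one_mul]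
  · have heq : ∀ r ∈ Set.Icc t T, expAddD A (r - t) 1 t = X t r := fun r hr => by
      rw [hexp (r - t) t (by linarith [hr.1]) ht.1 (by linarith [hr.2]), Pi.one_apply, one_mul,
        add_sub_cancel]
    rw [heq s hs]
    exact ((hX t ht).2 s hs).congr heq (heq s hs)
  · obtain ⟨m, rfl⟩ := Nat.exists_eq_add_of_le' hn
    -- With `n = m + 1`, smoothness `2n - 1 = 2m + 1` permits Taylor degree `2m` with a remainder of
    -- order `2m + 1`.
    have hA' : ContDiffOn ℝ ((2 * m : ℕ) + 1) A (Set.Icc 0 T) := by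
      have h1 : 2 * (m + 1) - 1 = 2 * m + 1 := by omega
      rw [h1] at hA
      exact_mod_cast hA
    obtain ⟨C, h₀, hh₀, hC⟩ := exists_norm_sum_prop_sub_solution_le hS hSn hT hA'
    refine ⟨C, h₀, hh₀, fun h t hh hhh₀ ht hth F K hF => ?_⟩
    have h1 := hC h t (X t) hh hhh₀ ht hth (hX' h t hh ht hth).1 (hX' h t hh ht hth).2
    have hFK : ‖F (t + h)‖ ≤ K := hF _ ⟨by linarith, hth⟩
    have hbd : ∀ Z : 𝔸, ‖Z‖ ≤ C * h ^ (2 * (m + 1)) →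
        ‖F (t + h) * Z‖ ≤ C * h ^ (2 * (m + 1)) * K := fun Z hZ => by
      rw [mul_comm _ K]
      exact (norm_mul_le _ _).trans
        (mul_le_mul hFK hZ (norm_nonneg _) ((norm_nonneg _).trans hFK))
    constructor
    · convert hbd _ h1.1 using 2
      rw [hexp h t hh ht hth F, RightOp.act_mpeSum, mul_sub, Finset.mul_sum]
      congr 1
      refine Finset.sum_congr rfl fun i hi => ?_
      rw [act_oddBasis_mul_shift (hS i hi), mul_smul_comm]
    · convert hbd _ h1.2 using 2
      rw [hexp h t hh ht hth F, RightOp.act_mpeSum, mul_sub, Finset.mul_sum]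
      congr 1
      refine Finset.sum_congr rfl fun i hi => ?_
      rw [act_oddBasis_shift_mul (hS i hi), mul_smul_comm]
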